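/- **Theorem 2.1** (lower semicontinuity of the life span and continuous dependence on initial data). Let $H$ be a real Hilbert space and let $A$ be a self-adjoint operator on $H$ with domain $D(A)$ such that $Ae_k=\lambda_k^2e_k$ for some countable orthonormal basis $\{e_k\}$ of $H$ and some real numbers $\lambda_k\ge 0$. For $s\ge 0$ let $D(A^s)=\{z\in H:\sum_k\lambda_k^{4s}\langle z,e_k\rangle^2<+\infty\}$ and $A^sz=\sum_k\lambda_k^{2s}\langle z,e_k\rangle e_k$ for $z\in D(A^s)$, with the graph norm $(|z|^2+|A^sz|^2)^{1/2}$ on $D(A^s)$. Let $m:[0,+\infty)\to\mathbb{R}$ be of class $C^1$ with $m(\sigma)\ge\nu_0>0$ for every $\sigma\ge 0$. For $(u_0,u_1)\in D(A^{3/4})\times D(A^{1/4})$ consider the Kirchhoff problem $$u''(t)+m\left(|A^{1/2}u(t)|^2\right)Au(t)=0,\qquad u(0)=u_0,\quad u'(0)=u_1. \tag{K}$$ A solution on $[0,T]$ is a function $u\in C^0([0,T],D(A^{3/4}))\cap C^1([0,T],D(A^{1/4}))$ that satisfies the initial conditions and, for every $\varphi\in D(A)$ and $t\in[0,T]$, the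 equation $\frac{d}{dt}\langle u'(t),\varphi\rangle=-m(|A^{1/2}u(t)|^2)\langle u(t),A\varphi\rangle$. Let $\mathcal{LS}(u_0,u_1)$ be the life span, that is, the supremum of all $T>0$ such that (K) has a solution on $[0,T]$ (possibly $+\infty$). For $(z_0,z_1)\in D(A^{3/4})\times D(A^{1/4})$ let $$E(z_0,z_1)=|z_1|^2+|A^{1/4}z_1|^2+|A^{1/2}z_0|^2+|A^{3/4}z_0|^2,$$ and let $E_z(t)=E(z(t),z'(t))$ for functions $z$ of time. Let $(u_0,u_1)$ and $(u_{0\varepsilon},u_{1\varepsilon})$, $\varepsilon>0$, be elements of $D(A^{3/4})\times D(A^{1/4})$ such that $(u_{0\varepsilon},u_{1\varepsilon})\to(u_0,u_1)$ in $D(A^{3/4})\times D(A^{1/4})$ as $\varepsilon\to 0^+$, and let $u$ and $u_\varepsilon$ denote the corresponding solutions of (K). Then: 1. $\displaystyle\liminf_{\varepsilon\to 0^+}\mathcal{LS}(u_{0\varepsilon},u_{1\varepsilon})\ge\mathcal{LS}(u_0,u_1)$. 2. For every positive $T<\mathcal{LS}(u_0,u_1)$ one has $T<\mathcal{LS}(u_{0\varepsilon},u_{1\varepsilon})$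 for all sufficiently small $\varepsilon>0$, and $E_{(u_\varepsilon-u)}(t)\to 0$ uniformly for $t\in[0,T]$ as $\varepsilon\to 0^+$. 3. If in addition $(u_0,u_1)\in D(A^{5/4})\times D(A^{3/4})$, then for every positive $T<\mathcal{LS}(u_0,u_1)$ there is a constant $\Gamma$, independent of $\varepsilon$, such that for all sufficiently small $\varepsilon>0$ (for which in particular $T<\mathcal{LS}(u_{0\varepsilon},u_{1\varepsilon})$) $$E_{(u_\varepsilon-u)}(t)\le\Gamma\,E_{(u_\varepsilon-u)}(0)\qquad\forall t\in[0,T].$$ -/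

import Mathlib

open Set Filter Topology

noncomputable section

variable {ι H : Type*} [NormedAddCommGroup H] [InnerProductSpace ℝ H]

/-- The standing assumption on `A`: it is a self-adjoint (unbounded, densely defined) operator
on `H`, and `A e_k = λ_k² e_k` for an orthonormal basis `e` and nonnegative reals `λ_k`. -/
structure IsDiagonalSelfAdjoint [CompleteSpace H] (A : H →ₗ.[ℝ] H) (e : HilbertBasis ι ℝ H)
    (lam : ι → ℝ) : Prop where
  dense_domain : Dense (A.domain : Set H)
  selfAdjoint : IsSelfAdjoint A
  lam_nonneg : ∀ k, 0 ≤ lam k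
  eigen : ∀ k, ∃ hk : e k ∈ A.domain, A ⟨e k, hk⟩ = (lam k ^ 2) • e k

/-- The domain `D(A^s)`: the vectors `z` with `∑ λ_k^{4s} ⟨z, e_k⟩² < ∞`. -/
def powDomain (e : HilbertBasis ι ℝ H) (lam : ι → ℝ) (s : ℝ) : Set H :=
  {z | Summable fun k => lam k ^ (4 * s) * (inner ℝ z (e k)) ^ 2}

/-- The vector `A^s z = ∑ λ_k^{2s} ⟨z, e_k⟩ e_k`, meaningful for `z ∈ D(A^s)`. -/
def powApply (e : HilbertBasis ι ℝ H) (lam : ι → ℝ) (s : ℝ) (z : H) : H :=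
  ∑' k, (lam k ^ (2 * s) * inner ℝ z (e k)) • e k

/-- Convergence of `f` to `z` along `l` in `D(A^s)`, that is in the graph norm
`(|z|² + |A^s z|²)^{1/2}`. -/
def TendstoInPow {α : Type*} (e : HilbertBasis ι ℝ H) (lam : ι → ℝ) (s : ℝ) (f : α → H)
    (l : Filter α) (z : H) : Prop :=
  Tendsto f l (𝓝 z) ∧ Tendsto (fun a => powApply e lam s (f a)) l (𝓝 (powApply e lam s z))

/-- `f ∈ C⁰([0,T], D(A^s))`, with the graph norm on `D(A^s)`. -/
def IsC0InPow (e : HilbertBasis ι ℝ H) (lam : ι → ℝ) (s T : ℝ) (f : ℝ → H) : Prop :=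
  (∀ t ∈ Icc 0 T, f t ∈ powDomain e lam s) ∧
    ∀ t ∈ Icc 0 T, TendstoInPow e lam s f (𝓝[Icc 0 T] t) (f t)

/-- `f ∈ C¹([0,T], D(A^s))` with derivative `f'`, with the graph norm on `D(A^s)`
(one-sided derivatives at the endpoints): `f` takes values in `D(A^s)`, both `f` and `A^s f` are
differentiable in `H` with derivatives `f'` and `A^s f'`, and `f' ∈ C⁰([0,T], D(A^s))`. -/
def IsC1InPow (e : HilbertBasis ι ℝ H) (lam : ι → ℝ) (s T : ℝ) (f f' : ℝ → H) : Prop :=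
  (∀ t ∈ Icc 0 T, f t ∈ powDomain e lam s) ∧
    (∀ t ∈ Icc 0 T, HasDerivWithinAt f (f' t) (Icc 0 T) t) ∧
    (∀ t ∈ Icc 0 T, HasDerivWithinAt (fun r => powApply e lam s (f r))
      (powApply e lam s (f' t)) (Icc 0 T) t) ∧
    IsC0InPow e lam s T f'

/-- `u`, with time derivative `v`, is a solution on `[0,T]` of
`u'' + m(|A^{1/2} u|²) A u = 0`, `u(0) = u₀`, `u'(0) = u₁`, in the class
`C⁰([0,T], D(A^{3/4})) ∩ C¹([0,T], D(A^{1/4}))`. Since `A u(t)` need not belong to `H`, the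
equation is tested with the vectors `φ ∈ D(A)`. -/
structure IsKirchhoffSolution (A : H →ₗ.[ℝ] H) (e : HilbertBasis ι ℝ H) (lam : ι → ℝ)
    (m : ℝ → ℝ) (T : ℝ) (u₀ u₁ : H) (u v : ℝ → H) : Prop where
  continuous : IsC0InPow e lam (3 / 4) T u
  differentiable : IsC1InPow e lam (1 / 4) T u v
  init_pos : u 0 = u₀
  init_vel : v 0 = u₁
  equation : ∀ φ : A.domain, ∀ t ∈ Icc 0 T,
    HasDerivWithinAt (fun r => inner ℝ (v r) (φ : H))
      (-(m (‖powApply e lam (1 / 2) (u t)‖ ^ 2) * inner ℝ (u t) (A φ))) (Icc 0 T) t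

/-- The life span `LS(u₀,u₁) ∈ [0,∞]`: the supremum of the times `T > 0` such that a solution
exists on `[0,T]`. -/
def lifeSpan (A : H →ₗ.[ℝ] H) (e : HilbertBasis ι ℝ H) (lam : ι → ℝ) (m : ℝ → ℝ)
    (u₀ u₁ : H) : ENNReal :=
  sSup {τ | ∃ T : ℝ, 0 < T ∧ τ = ENNReal.ofReal T ∧
    ∃ u v : ℝ → H, IsKirchhoffSolution A e lam m T u₀ u₁ u v}

/-- The energy `E(z₀,z₁) = |z₁|² + |A^{1/4} z₁|² + |A^{1/2} z₀|² + |A^{3/4} z₀|²`. -/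
def kirchhoffEnergy (e : HilbertBasis ι ℝ H) (lam : ι → ℝ) (z₀ z₁ : H) : ℝ :=
  ‖z₁‖ ^ 2 + ‖powApply e lam (1 / 4) z₁‖ ^ 2 + ‖powApply e lam (1 / 2) z₀‖ ^ 2
    + ‖powApply e lam (3 / 4) z₀‖ ^ 2

end

/-! In the eigenbasis the equation is a family of oscillators `u_k'' + c(t) λ_k² u_k = 0` coupled
only through the speed `c = m(|A^{1/2}u|²)`. The derivative of `|A^{1/2}u|²` is `2⟨A^{3/4}u,
A^{1/4}u'⟩`, so a bound on `E` makes `c` Lipschitz, and each mode grows at most by a constant factor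
independent of `λ_k` (`exists_mode_growth`).

The difference of two solutions solves the same kind of equation with source `(c - d) λ_k² u_k`,
which costs one power of `λ_k` too many for a Lipschitz estimate in `E`. In the weaker norm with
weight `1/(1+λ_k)` instead of `1+λ_k` the source is controlled by `E`, and Cauchy–Schwarz bounds `c
- d` by that same weak norm, so Grönwall closes (`exists_weighted_lipschitz`). To return to `E`, the
modes are split: on finitely many low modes with `λ_k ≤ Λ` the two norms differ by a factor
`(1+Λ)²`, and the high modes are bounded, by mode growth, through the tails of the initial data
(`exists_energy_sub_le`). A continuity argument removes the a priori energy bound on the second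
solution (`exists_stability`). The cutoff depends on the data of `u`, so this yields continuity but
no rate. For data one derivative smoother the source is controlled with weight `1+λ_k` itself, which
gives the Lipschitz rate (`exists_energy_lipschitz`).

For the life span, truncations of nearby data to finitely many modes have solutions on all of
`[0,T]` by conservation of the Hamiltonian (`exists_finite_mode_solution`). Stability keeps them
near `u`, the low/high splitting makes them uniformly Cauchy, and their limit is a solution on
`[0,T]` (`exists_solution_near`). Stability is proved against every solution with nearby data, so
uniqueness needs no separate argument. -/

/-! ### Calculus on an interval: primitives, Grönwall, continuation. -/

theorem hasDerivWithinAt_integral_Icc {E : Type*} [NormedAddCommGroup E] [NormedSpace ℝ E]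
    [CompleteSpace E] {T : ℝ} {f : ℝ → E} (hf : ContinuousOn f (Icc 0 T)) {t : ℝ}
    (ht : t ∈ Icc 0 T) :
    HasDerivWithinAt (fun r => ∫ x in (0 : ℝ)..r, f x) (f t) (Icc 0 T) t := by
  have hT : (0 : ℝ) ≤ T := ht.1.trans ht.2
  -- Constant extension beyond the endpoints makes the integrand continuous on the whole line, so
  -- the fundamental theorem also covers the endpoints.
  set g : ℝ → E := IccExtend hT ((Icc 0 T).domRestrict f) with hg
  have hgc : Continuous g := (continuousOn_iff_continuous_domRestrict.1 hf).Icc_extend'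
  have hgf : ∀ x ∈ Icc 0 T, g x = f x := fun x hx => by
    rw [hg, IccExtend_of_mem _ _ hx]; rfl
  have h1 : HasDerivWithinAt (fun r => ∫ x in (0 : ℝ)..r, g x) (g t) (Icc 0 T) t :=
    (hgc.integral_hasStrictDerivAt 0 t).hasDerivAt.hasDerivWithinAt
  have h2 : ∀ r ∈ Icc 0 T, (∫ x in (0 : ℝ)..r, f x) = ∫ x in (0 : ℝ)..r, g x := fun r hr =>
    intervalIntegral.integral_congr fun x hx => by
      rw [uIcc_of_le hr.1] at hx
      exact (hgf x ⟨hx.1, hx.2.trans hr.2⟩).symm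
  rw [← hgf t ht]
  exact h1.congr h2 (h2 t ht)

theorem eq_add_integral_of_hasDerivWithinAt {E : Type*} [NormedAddCommGroup E] [NormedSpace ℝ E]
    [CompleteSpace E] {T : ℝ} {f f' : ℝ → E}
    (hf : ∀ t ∈ Icc 0 T, HasDerivWithinAt f (f' t) (Icc 0 T) t)
    (hf' : ContinuousOn f' (Icc 0 T)) {t : ℝ} (ht : t ∈ Icc 0 T) :
    f t = f 0 + ∫ x in (0 : ℝ)..t, f' x := by
  have hs : Icc 0 t ⊆ Icc 0 T := Icc_subset_Icc_right ht.2
  rw [intervalIntegral.integral_eq_sub_of_hasDerivAt_of_le (f := f) ht.1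
    (fun x hx => ((hf x (hs hx)).continuousWithinAt).mono hs)
    (fun x hx => (hf x (hs (Ioo_subset_Icc_self hx))).hasDerivAt
      (Icc_mem_nhds hx.1 (hx.2.trans_le ht.2)))
    ((hf'.mono hs).intervalIntegrable_of_Icc ht.1)]
  abel

/-- Integral form of Grönwall's inequality for `f' ≤ a f + b`. -/
theorem le_exp_mul_of_deriv_le {T a : ℝ} {f f' b : ℝ → ℝ} (ha : 0 ≤ a)
    (hf : ∀ t ∈ Icc 0 T, HasDerivWithinAt f (f' t) (Icc 0 T) t)
    (hb : ContinuousOn b (Icc 0 T)) (hb0 : ∀ t ∈ Icc 0 T, 0 ≤ b t)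
    (hle : ∀ t ∈ Icc 0 T, f' t ≤ a * f t + b t) {t : ℝ} (ht : t ∈ Icc 0 T) :
    f t ≤ Real.exp (a * t) * (f 0 + ∫ x in (0 : ℝ)..t, b x) := by
  have hT : (0 : ℝ) ≤ T := ht.1.trans ht.2
  -- Integrating factor. The function `e^{-ar} f - ∫ b` is nonincreasing: `a ≥ 0` gives `e^{-ar} ≤
  -- 1`, and `b ≥ 0` then gives `e^{-ar} b ≤ b`.
  have hd : ∀ r ∈ Icc 0 T, HasDerivWithinAt
      (fun r => Real.exp (-(a * r)) * f r - ∫ x in (0 : ℝ)..r, b x)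
      (Real.exp (-(a * r)) * (-a) * f r + Real.exp (-(a * r)) * f' r - b r) (Icc 0 T) r := by
    intro r hr
    have h1 : HasDerivAt (fun r => Real.exp (-(a * r))) (Real.exp (-(a * r)) * (-a)) r := by
      simpa using (((hasDerivAt_id r).const_mul a).neg).exp
    exact (h1.hasDerivWithinAt.mul (hf r hr)).sub (hasDerivWithinAt_integral_Icc hb hr)
  have hanti : AntitoneOn (fun r => Real.exp (-(a * r)) * f r - ∫ x in (0 : ℝ)..r, b x)
      (Icc 0 T) := by
    refine antitoneOn_of_hasDerivWithinAt_nonpos (convex_Icc 0 T)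
      (fun r hr => (hd r hr).continuousWithinAt)
      (fun r hr => (hd r (interior_subset hr)).mono interior_subset) fun r hr => ?_
    have hr' := interior_subset hr
    have h1 := hle r hr'
    have h2 : Real.exp (-(a * r)) ≤ 1 := Real.exp_le_one_iff.2 (by nlinarith [hr'.1])
    have h3 := Real.exp_pos (-(a * r))
    nlinarith [hb0 r hr', mul_le_mul_of_nonneg_left h1 h3.le]
  have h := hanti ⟨le_rfl, hT⟩ ht ht.1
  simp only [mul_zero, neg_zero, Real.exp_zero, one_mul, intervalIntegral.integral_same,
    sub_zero] at h
  have h4 : f t = Real.exp (a * t) * (Real.exp (-(a * t)) * f t) := by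
    rw [← mul_assoc, ← Real.exp_add]; simp
  rw [h4]
  exact mul_le_mul_of_nonneg_left (by linarith) (Real.exp_pos _).le

/-- A continuity argument: a continuous function starting below `1`, which is at most `θ < 1` as
long as it has stayed below `1`, is at most `θ` throughout. -/
theorem le_of_bootstrap {T θ : ℝ} {f : ℝ → ℝ} (hf : ContinuousOn f (Icc 0 T)) (hθ : θ < 1)
    (h0 : f 0 < 1)
    (h : ∀ t ∈ Icc 0 T, (∀ r ∈ Icc 0 t, f r ≤ 1) → f t ≤ θ) : ∀ t ∈ Icc 0 T, f t ≤ θ := by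
  have key : ∀ t ∈ Icc 0 T, f t ≤ 1 := by
    by_contra! hcon
    obtain ⟨t₁, ht₁, hft₁⟩ := hcon
    have hT : (0 : ℝ) ≤ T := ht₁.1.trans ht₁.2
    have hcl : IsClosed (Icc 0 T ∩ f ⁻¹' Ici 1) := hf.preimage_isClosed_of_isClosed isClosed_Icc
      isClosed_Ici
    have hcpt : IsCompact (Icc 0 T ∩ f ⁻¹' Ici 1) :=
      isCompact_Icc.of_isClosed_subset hcl inter_subset_left
    -- Let `r` be the first time with `f r ≥ 1`. Continuity from the left gives `f ≤ 1` on `[0,r]`,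
    -- so the hypothesis forces `f r ≤ θ < 1`, a contradiction.
    obtain ⟨r, ⟨hr, hfr⟩, hmin⟩ := hcpt.exists_isLeast ⟨t₁, ht₁, hft₁.le⟩
    have hlt : ∀ x ∈ Ico 0 r, f x < 1 := fun x hx => by
      by_contra! hx1
      exact absurd (hmin ⟨⟨hx.1, hx.2.le.trans hr.2⟩, hx1⟩) (not_le.2 hx.2)
    have hr0 : 0 < r := by
      rcases hr.1.eq_or_lt with h' | h'
      · rw [← h'] at hfr; exact absurd h0 (not_lt.2 hfr)
      · exact h'
    have hfr1 : f r ≤ 1 := by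
      have hc : ContinuousWithinAt f (Ico 0 r) r :=
        (hf r hr).mono fun x hx => ⟨hx.1, hx.2.le.trans hr.2⟩
      have : (𝓝[Ico 0 r] r).NeBot := by
        rw [← mem_closure_iff_nhdsWithin_neBot, closure_Ico hr0.ne]
        exact ⟨hr0.le, le_rfl⟩
      exact le_of_tendsto hc (eventually_nhdsWithin_of_forall fun x hx => (hlt x hx).le)
    have := h r hr fun x hx => by
      rcases hx.2.eq_or_lt with h' | h'
      · rw [h']; exact hfr1
      · exact (hlt x ⟨hx.1, h'⟩).le
    exact absurd hfr (not_le.2 (this.trans_lt hθ))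
  exact fun t ht => h t ht fun r hr => key r ⟨hr.1, hr.2.trans ht.2⟩

/-! ### Energy estimates for oscillators with time-dependent speed. -/

/-- The modes `u k` solve `u k'' + c λ_k² u k = 0` on `[0,T]`, with derivatives `v k`. -/
structure IsModeSolution {ι : Type*} (lam : ι → ℝ) (T : ℝ) (c : ℝ → ℝ) (u v : ι → ℝ → ℝ) :
    Prop where
  pos : ∀ k, ∀ t ∈ Icc 0 T, HasDerivWithinAt (u k) (v k t) (Icc 0 T) t
  vel : ∀ k, ∀ t ∈ Icc 0 T,
    HasDerivWithinAt (v k) (-(c t * (lam k ^ 2 * u k t))) (Icc 0 T) t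

/-- A propagation speed `c` with `ν ≤ c ≤ M` and `|c'| ≤ K` on `[0,T]`. -/
structure IsSpeed (T ν M K : ℝ) (c : ℝ → ℝ) : Prop where
  lower : ∀ t ∈ Icc 0 T, ν ≤ c t
  upper : ∀ t ∈ Icc 0 T, c t ≤ M
  deriv : ∃ c' : ℝ → ℝ, ∀ t ∈ Icc 0 T, HasDerivWithinAt c (c' t) (Icc 0 T) t ∧ |c' t| ≤ K

section ModeEstimates

variable {ι : Type*} {lam : ι → ℝ} {T ν M K : ℝ}

/-- The equation cancels everything in the derivative of `v² + c λ² u²` except `c' λ² u²`, which is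
at most `K/ν` times the energy. The factors `1 + 1/ν` and `1 + M` remove the weight `c` at time `t`
and insert it at time `0`. No constant depends on `λ_k`, or on `T'` except through `T' ≤ T`. -/
theorem IsModeSolution.energy_le {c : ℝ → ℝ} {u v : ι → ℝ → ℝ} {T' : ℝ} (hT : T' ≤ T)
    (hν : 0 < ν) (hM : 0 ≤ M) (hK : 0 ≤ K) (h : IsModeSolution lam T' c u v)
    (hc : IsSpeed T' ν M K c) (k : ι) {t : ℝ} (ht : t ∈ Icc 0 T') :
    v k t ^ 2 + lam k ^ 2 * u k t ^ 2 ≤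
      (1 + 1 / ν) * (1 + M) * Real.exp (K / ν * T) * (v k 0 ^ 2 + lam k ^ 2 * u k 0 ^ 2) := by
  obtain ⟨c', hc'⟩ := hc.deriv
  have h0 : (0 : ℝ) ∈ Icc 0 T' := ⟨le_rfl, ht.1.trans ht.2⟩
  have hd : ∀ r ∈ Icc 0 T', HasDerivWithinAt
      (fun r => v k r ^ 2 + c r * (lam k ^ 2 * u k r ^ 2))
      (c' r * (lam k ^ 2 * u k r ^ 2)) (Icc 0 T') r := fun r hr => by
    refine (((h.vel k r hr).pow 2).add
      ((hc' r hr).1.mul (((h.pos k r hr).pow 2).const_mul (lam k ^ 2)))).congr_deriv ?_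
    simp; ring
  have hKν : 0 ≤ K / ν := by positivity
  have hle := le_exp_mul_of_deriv_le (b := fun _ => 0) hKν hd continuousOn_const
    (fun _ _ => le_rfl) (fun r hr => by
      have h1 := (abs_le.1 (hc' r hr).2).2
      have h2 : 0 ≤ lam k ^ 2 * u k r ^ 2 := by positivity
      have h3 := mul_le_mul_of_nonneg_right h1 h2
      have h4 : K * (lam k ^ 2 * u k r ^ 2) = K / ν * (ν * (lam k ^ 2 * u k r ^ 2)) := by
        field_simp
      have h5 : ν * (lam k ^ 2 * u k r ^ 2) ≤ v k r ^ 2 + c r * (lam k ^ 2 * u k r ^ 2) := by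
        nlinarith [sq_nonneg (v k r), mul_le_mul_of_nonneg_right (hc.lower r hr) h2]
      nlinarith [mul_le_mul_of_nonneg_left h5 hKν]) ht
  simp only [intervalIntegral.integral_zero, add_zero] at hle
  have h2 : 0 ≤ lam k ^ 2 * u k t ^ 2 := by positivity
  have h20 : 0 ≤ lam k ^ 2 * u k 0 ^ 2 := by positivity
  have hA : v k t ^ 2 + lam k ^ 2 * u k t ^ 2 ≤
      (1 + 1 / ν) * (v k t ^ 2 + c t * (lam k ^ 2 * u k t ^ 2)) := by
    have h5 := mul_le_mul_of_nonneg_right (hc.lower t ht) h2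
    have h6 : (1 / ν) * (ν * (lam k ^ 2 * u k t ^ 2)) = lam k ^ 2 * u k t ^ 2 := by field_simp
    have h7 : 0 < 1 / ν := by positivity
    have h8 : 0 ≤ ν * (lam k ^ 2 * u k t ^ 2) := by positivity
    nlinarith [mul_le_mul_of_nonneg_left h5 h7.le, sq_nonneg (v k t),
      mul_nonneg h7.le (sq_nonneg (v k t))]
  have hB : v k 0 ^ 2 + c 0 * (lam k ^ 2 * u k 0 ^ 2) ≤
      (1 + M) * (v k 0 ^ 2 + lam k ^ 2 * u k 0 ^ 2) := by
    nlinarith [mul_le_mul_of_nonneg_right (hc.upper 0 h0) h20, mul_nonneg hM (sq_nonneg (v k 0))]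
  have hexp : Real.exp (K / ν * t) ≤ Real.exp (K / ν * T) :=
    Real.exp_le_exp.2 (mul_le_mul_of_nonneg_left (ht.2.trans hT) hKν)
  have hS : 0 ≤ (1 + M) * (v k 0 ^ 2 + lam k ^ 2 * u k 0 ^ 2) := by positivity
  calc _ ≤ (1 + 1 / ν) * (v k t ^ 2 + c t * (lam k ^ 2 * u k t ^ 2)) := hA
    _ ≤ (1 + 1 / ν) * (Real.exp (K / ν * T) *
          ((1 + M) * (v k 0 ^ 2 + lam k ^ 2 * u k 0 ^ 2))) := by
        refine mul_le_mul_of_nonneg_left ?_ (by positivity)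
        refine hle.trans ?_
        refine (mul_le_mul_of_nonneg_left hB (Real.exp_pos _).le).trans ?_
        exact mul_le_mul_of_nonneg_right hexp hS
    _ = _ := by ring

/-- The difference `w = y - u` satisfies `w'' + d λ² w = (c - d) λ² u`. Its energy is estimated with
the speed `d`, and Young's inequality splits the source into `(d - c)² λ⁴ u²`, summed by `B`, and
`(w')²`, responsible for the `+ 1` in the exponent. Finite sums keep differentiation elementary,
with a bound independent of `s`. -/
theorem IsModeSolution.sum_sub_le {c d : ℝ → ℝ} {u v y z : ι → ℝ → ℝ} {T' B : ℝ} (hT : T' ≤ T)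
    (hν : 0 < ν) (hM : 0 ≤ M) (hK : 0 ≤ K) (h : IsModeSolution lam T' c u v)
    (h' : IsModeSolution lam T' d y z) (hd : IsSpeed T' ν M K d) {ω : ι → ℝ} (hω : ∀ k, 0 ≤ ω k)
    {s : Finset ι} (hB : ∀ t ∈ Icc 0 T', ∑ k ∈ s, ω k * (lam k ^ 4 * u k t ^ 2) ≤ B)
    {ψ : ℝ → ℝ} (hψc : ContinuousOn ψ (Icc 0 T')) (hψ : ∀ t ∈ Icc 0 T', (d t - c t) ^ 2 ≤ ψ t)
    (hB0 : 0 ≤ B) {t : ℝ} (ht : t ∈ Icc 0 T') :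
    ∑ k ∈ s, ω k * ((z k t - v k t) ^ 2 + lam k ^ 2 * (y k t - u k t) ^ 2) ≤
      (1 + 1 / ν) * (1 + M) * Real.exp ((K / ν + 1) * T) *
        (∑ k ∈ s, ω k * ((z k 0 - v k 0) ^ 2 + lam k ^ 2 * (y k 0 - u k 0) ^ 2)
          + B * ∫ r in (0 : ℝ)..t, ψ r) := by
  obtain ⟨d', hd'⟩ := hd.deriv
  have h0 : (0 : ℝ) ∈ Icc 0 T' := ⟨le_rfl, ht.1.trans ht.2⟩
  have hψ0 : ∀ t ∈ Icc 0 T', 0 ≤ ψ t := fun t ht => (sq_nonneg _).trans (hψ t ht)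
  set G : ℝ → ℝ := fun r => ∑ k ∈ s,
    ω k * ((z k r - v k r) ^ 2 + d r * (lam k ^ 2 * (y k r - u k r) ^ 2)) with hG
  have hder : ∀ r ∈ Icc 0 T', HasDerivWithinAt G (∑ k ∈ s,
      ω k * (d' r * (lam k ^ 2 * (y k r - u k r) ^ 2)
        - 2 * (d r - c r) * lam k ^ 2 * u k r * (z k r - v k r))) (Icc 0 T') r := fun r hr => by
    refine HasDerivWithinAt.fun_sum fun k _ => HasDerivWithinAt.const_mul _ ?_
    refine ((((h'.vel k r hr).sub (h.vel k r hr)).pow 2).add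
      ((hd' r hr).1.mul ((((h'.pos k r hr).sub (h.pos k r hr)).pow 2).const_mul
        (lam k ^ 2)))).congr_deriv ?_
    simp; ring
  have ha : 0 ≤ K / ν + 1 := by positivity
  have hKν : 0 ≤ K / ν := by positivity
  have hle := le_exp_mul_of_deriv_le (b := fun r => B * ψ r) ha hder
    (continuousOn_const.mul hψc) (fun r hr => mul_nonneg hB0 (hψ0 r hr)) (fun r hr => by
      have hterm : ∀ k ∈ s, ω k * (d' r * (lam k ^ 2 * (y k r - u k r) ^ 2)
          - 2 * (d r - c r) * lam k ^ 2 * u k r * (z k r - v k r)) ≤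
          (K / ν + 1) * (ω k * ((z k r - v k r) ^ 2
            + d r * (lam k ^ 2 * (y k r - u k r) ^ 2)))
          + ψ r * (ω k * (lam k ^ 4 * u k r ^ 2)) := fun k _ => by
        have h2 : 0 ≤ lam k ^ 2 * (y k r - u k r) ^ 2 := by positivity
        have h1 := mul_le_mul_of_nonneg_right (abs_le.1 (hd' r hr).2).2 h2
        have h4 : K * (lam k ^ 2 * (y k r - u k r) ^ 2)
            = K / ν * (ν * (lam k ^ 2 * (y k r - u k r) ^ 2)) := by field_simp
        have h5 := mul_le_mul_of_nonneg_right (hd.lower r hr) h2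
        have h6 := mul_le_mul_of_nonneg_left h5 hKν
        have h7 : 0 ≤ d r * (lam k ^ 2 * (y k r - u k r) ^ 2) :=
          mul_nonneg (hν.le.trans (hd.lower r hr)) h2
        have h8 := mul_le_mul_of_nonneg_right (hψ r hr)
          (by positivity : 0 ≤ lam k ^ 4 * u k r ^ 2)
        -- Young's inequality for the product of the source with the velocity.
        have h9 := sq_nonneg ((d r - c r) * lam k ^ 2 * u k r + (z k r - v k r))
        have h10 := mul_nonneg hKν (sq_nonneg (z k r - v k r))
        have : d' r * (lam k ^ 2 * (y k r - u k r) ^ 2)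
          - 2 * (d r - c r) * lam k ^ 2 * u k r * (z k r - v k r) ≤
          (K / ν + 1) * ((z k r - v k r) ^ 2 + d r * (lam k ^ 2 * (y k r - u k r) ^ 2))
          + ψ r * (lam k ^ 4 * u k r ^ 2) := by linarith
        calc _ ≤ _ := mul_le_mul_of_nonneg_left this (hω k)
          _ = _ := by ring
      refine (Finset.sum_le_sum hterm).trans ?_
      rw [Finset.sum_add_distrib, ← Finset.mul_sum, ← Finset.mul_sum, mul_comm B]
      exact add_le_add le_rfl (mul_le_mul_of_nonneg_left (hB r hr) (hψ0 r hr))) ht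
  rw [intervalIntegral.integral_const_mul] at hle
  have hA : ∑ k ∈ s, ω k * ((z k t - v k t) ^ 2 + lam k ^ 2 * (y k t - u k t) ^ 2) ≤
      (1 + 1 / ν) * G t := by
    rw [hG, Finset.mul_sum]
    refine Finset.sum_le_sum fun k _ => ?_
    have h2 : 0 ≤ lam k ^ 2 * (y k t - u k t) ^ 2 := by positivity
    have h5 := mul_le_mul_of_nonneg_right (hd.lower t ht) h2
    have h6 : (1 / ν) * (ν * (lam k ^ 2 * (y k t - u k t) ^ 2))
      = lam k ^ 2 * (y k t - u k t) ^ 2 := by field_simp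
    have h7 : 0 < 1 / ν := by positivity
    have h8 : 0 ≤ ν * (lam k ^ 2 * (y k t - u k t) ^ 2) := by positivity
    have := mul_le_mul_of_nonneg_left h5 h7.le
    have h9 := mul_nonneg h7.le (sq_nonneg (z k t - v k t))
    have : (z k t - v k t) ^ 2 + lam k ^ 2 * (y k t - u k t) ^ 2 ≤ (1 + 1 / ν) *
      ((z k t - v k t) ^ 2 + d t * (lam k ^ 2 * (y k t - u k t) ^ 2)) := by linarith
    calc _ ≤ _ := mul_le_mul_of_nonneg_left this (hω k)
      _ = _ := by ring
  have hG0 : G 0 ≤ (1 + M) *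
      ∑ k ∈ s, ω k * ((z k 0 - v k 0) ^ 2 + lam k ^ 2 * (y k 0 - u k 0) ^ 2) := by
    rw [hG, Finset.mul_sum]
    refine Finset.sum_le_sum fun k _ => ?_
    have h20 : 0 ≤ lam k ^ 2 * (y k 0 - u k 0) ^ 2 := by positivity
    have h5 := mul_le_mul_of_nonneg_right (hd.upper 0 h0) h20
    have h6 := mul_nonneg hM (sq_nonneg (z k 0 - v k 0))
    have : (z k 0 - v k 0) ^ 2 + d 0 * (lam k ^ 2 * (y k 0 - u k 0) ^ 2) ≤ (1 + M) *
      ((z k 0 - v k 0) ^ 2 + lam k ^ 2 * (y k 0 - u k 0) ^ 2) := by linarith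
    calc _ ≤ _ := mul_le_mul_of_nonneg_left this (hω k)
      _ = _ := by ring
  have hI : 0 ≤ B * ∫ r in (0 : ℝ)..t, ψ r := mul_nonneg hB0
    (intervalIntegral.integral_nonneg ht.1 fun r hr => hψ0 r ⟨hr.1, hr.2.trans ht.2⟩)
  have hS : 0 ≤ ∑ k ∈ s, ω k * ((z k 0 - v k 0) ^ 2 + lam k ^ 2 * (y k 0 - u k 0) ^ 2) :=
    Finset.sum_nonneg fun k _ => mul_nonneg (hω k) (by positivity)
  have hexp : Real.exp ((K / ν + 1) * t) ≤ Real.exp ((K / ν + 1) * T) :=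
    Real.exp_le_exp.2 (mul_le_mul_of_nonneg_left (ht.2.trans hT) ha)
  have hsum : G 0 + B * ∫ r in (0 : ℝ)..t, ψ r ≤ (1 + M) *
      (∑ k ∈ s, ω k * ((z k 0 - v k 0) ^ 2 + lam k ^ 2 * (y k 0 - u k 0) ^ 2)
        + B * ∫ r in (0 : ℝ)..t, ψ r) := by
    nlinarith [mul_nonneg hM hI]
  calc _ ≤ (1 + 1 / ν) * G t := hA
    _ ≤ (1 + 1 / ν) * (Real.exp ((K / ν + 1) * T) * ((1 + M) *
      (∑ k ∈ s, ω k * ((z k 0 - v k 0) ^ 2 + lam k ^ 2 * (y k 0 - u k 0) ^ 2)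
        + B * ∫ r in (0 : ℝ)..t, ψ r))) := by
        refine mul_le_mul_of_nonneg_left ?_ (by positivity)
        refine hle.trans ?_
        refine (mul_le_mul_of_nonneg_left hsum (Real.exp_pos _).le).trans ?_
        exact mul_le_mul_of_nonneg_right hexp (by positivity)
    _ = _ := by ring

/-- Lipschitz dependence in a weighted energy norm, when the difference of the two propagation
speeds is controlled by the weighted norm of the difference of the modes. -/
theorem IsModeSolution.exists_sum_sub_le {B D : ℝ} (hν : 0 < ν) (hM : 0 ≤ M) (hK : 0 ≤ K)
    (hB0 : 0 ≤ B) (hD : 0 ≤ D) (T : ℝ) :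
    ∃ C : ℝ, 0 ≤ C ∧ ∀ (lam ω : ι → ℝ) (T' : ℝ) (c d ψ : ℝ → ℝ) (u v y z : ι → ℝ → ℝ),
      T' ≤ T → (∀ k, 0 ≤ ω k) → IsModeSolution lam T' c u v → IsModeSolution lam T' d y z →
      IsSpeed T' ν M K d →
      (∀ s : Finset ι, ∀ t ∈ Icc 0 T', ∑ k ∈ s, ω k * (lam k ^ 4 * u k t ^ 2) ≤ B) →
      ContinuousOn ψ (Icc 0 T') → (∀ t ∈ Icc 0 T', (d t - c t) ^ 2 ≤ ψ t) →
      (∀ t ∈ Icc 0 T', ∀ g : ℝ,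
        (∀ s : Finset ι, ∑ k ∈ s, ω k * (lam k ^ 2 * (y k t - u k t) ^ 2) ≤ g) → ψ t ≤ D * g) →
      ∀ G : ℝ, (∀ s : Finset ι,
        ∑ k ∈ s, ω k * ((z k 0 - v k 0) ^ 2 + lam k ^ 2 * (y k 0 - u k 0) ^ 2) ≤ G) →
      ∀ t ∈ Icc 0 T', ∀ s : Finset ι,
        ∑ k ∈ s, ω k * ((z k t - v k t) ^ 2 + lam k ^ 2 * (y k t - u k t) ^ 2) ≤ C * G := by
  -- For `T < 0` the interval `[0,T']` is empty; otherwise `T ≥ 0` makes the constant below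
  -- nonnegative.
  rcases lt_or_ge T 0 with hT0 | hT0
  · exact ⟨0, le_rfl, fun lam ω T' c d ψ u v y z hT _ _ _ _ _ _ _ _ G _ t ht =>
      absurd (ht.1.trans (ht.2.trans hT)) (not_le.2 hT0)⟩
  set C₁ : ℝ := (1 + 1 / ν) * (1 + M) * Real.exp ((K / ν + 1) * T) with hC₁
  have hC₁0 : 0 ≤ C₁ := by positivity
  refine ⟨C₁ * (1 + B * (Real.exp (D * C₁ * B * T) * (T * (D * C₁)))), by positivity, ?_⟩
  intro lam ω T' c d ψ u v y z hT hω h h' hd hB hψc hψ hψD G hG t ht s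
  have hG0 : 0 ≤ G := by simpa using hG ∅
  have hψ0 : ∀ t ∈ Icc 0 T', 0 ≤ ψ t := fun t ht => (sq_nonneg _).trans (hψ t ht)
  have key : ∀ r ∈ Icc 0 T', ∀ s : Finset ι,
      ∑ k ∈ s, ω k * ((z k r - v k r) ^ 2 + lam k ^ 2 * (y k r - u k r) ^ 2) ≤
        C₁ * (G + B * ∫ x in (0 : ℝ)..r, ψ x) := fun r hr s =>
    (h.sum_sub_le hT hν hM hK h' hd hω (hB s) hψc hψ hB0 hr).trans
      (mul_le_mul_of_nonneg_left (add_le_add (hG s) le_rfl) hC₁0)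
  -- The speed gap is bounded by the norm being estimated, so `ψ ≤ D C₁ (G + B ∫ ψ)`. A second
  -- Grönwall argument, applied to `∫ ψ`, bounds it by a multiple of `G`.
  have hψle : ∀ r ∈ Icc 0 T', ψ r ≤ D * C₁ * B * (∫ x in (0 : ℝ)..r, ψ x) + D * C₁ * G :=
    fun r hr => by
      refine (hψD r hr _ fun s => le_trans (Finset.sum_le_sum fun k _ => ?_)
        (key r hr s)).trans_eq (by ring)
      exact mul_le_mul_of_nonneg_left (by nlinarith [sq_nonneg (z k r - v k r)]) (hω k)
  have hΨ := le_exp_mul_of_deriv_le (b := fun _ => D * C₁ * G) (a := D * C₁ * B) (by positivity)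
    (fun r hr => hasDerivWithinAt_integral_Icc hψc hr) continuousOn_const
    (fun _ _ => by positivity) hψle ht
  simp only [intervalIntegral.integral_same, zero_add, intervalIntegral.integral_const, sub_zero,
    smul_eq_mul] at hΨ
  have hexp : Real.exp (D * C₁ * B * t) ≤ Real.exp (D * C₁ * B * T) :=
    Real.exp_le_exp.2 (mul_le_mul_of_nonneg_left (ht.2.trans hT) (by positivity))
  have hΨ' : ∫ x in (0 : ℝ)..t, ψ x ≤ Real.exp (D * C₁ * B * T) * (T * (D * C₁ * G)) :=
    hΨ.trans (mul_le_mul hexp (mul_le_mul_of_nonneg_right (ht.2.trans hT) (by positivity))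
      (mul_nonneg ht.1 (by positivity)) (Real.exp_pos _).le)
  calc _ ≤ _ := key t ht s
    _ ≤ C₁ * (G + B * (Real.exp (D * C₁ * B * T) * (T * (D * C₁ * G)))) := by gcongr
    _ = _ := by ring

end ModeEstimates

/-! ### Coordinates, fractional powers and the energy as a series. -/

section Coordinates

variable {ι H : Type*} [NormedAddCommGroup H] [InnerProductSpace ℝ H] {e : HilbertBasis ι ℝ H}
  {lam : ι → ℝ} {s : ℝ} {x y z : H}

theorem hasSum_coord_mul_coord (e : HilbertBasis ι ℝ H) (x y : H) :
    HasSum (fun k => inner ℝ x (e k) * inner ℝ y (e k)) (inner ℝ x y) := by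
  simpa [real_inner_comm y] using e.hasSum_inner_mul_inner x y

theorem hasSum_coord_sq (e : HilbertBasis ι ℝ H) (x : H) :
    HasSum (fun k => inner ℝ x (e k) ^ 2) (‖x‖ ^ 2) := by
  simpa [← pow_two] using hasSum_coord_mul_coord e x x

theorem ext_coord (e : HilbertBasis ι ℝ H) (h : ∀ k, inner ℝ x (e k) = inner ℝ y (e k)) :
    x = y := by
  have h2 := hasSum_coord_sq e (x - y)
  simp only [inner_sub_left, h, sub_self, ne_eq, OfNat.ofNat_ne_zero, not_false_eq_true,
    zero_pow] at h2
  have h3 := h2.unique hasSum_zero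
  exact sub_eq_zero.1 (by simpa using h3)

theorem rpow_sq_eq (hl : ∀ k, 0 ≤ lam k) (k : ι) : (lam k ^ (2 * s)) ^ 2 = lam k ^ (4 * s) := by
  rw [← Real.rpow_natCast, ← Real.rpow_mul (hl k)]
  congr 1; push_cast; ring

theorem inner_powApply (hl : ∀ k, 0 ≤ lam k) (hz : z ∈ powDomain e lam s) (k : ι) :
    inner ℝ (powApply e lam s z) (e k) = lam k ^ (2 * s) * inner ℝ z (e k) := by
  have hmem : Memℓp (fun k => lam k ^ (2 * s) * inner ℝ z (e k)) 2 := by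
    refine memℓp_gen ?_
    refine Summable.congr hz fun k => ?_
    simp [mul_pow, rpow_sq_eq hl]
  have h := e.hasSum_repr_symm ⟨_, hmem⟩
  have h1 : powApply e lam s z = e.repr.symm ⟨_, hmem⟩ := h.tsum_eq
  rw [h1, real_inner_comm, ← e.repr_apply_apply, LinearIsometryEquiv.apply_symm_apply]

/-- Parseval for `y` supplies the summability that defines the domain, and expanding `y` in the
basis gives the value. Additivity, truncation and closedness of `A^s` all reduce to this coordinate
test. -/
theorem mem_powDomain_and_powApply_eq (hl : ∀ k, 0 ≤ lam k)
    (h : ∀ k, inner ℝ y (e k) = lam k ^ (2 * s) * inner ℝ z (e k)) :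
    z ∈ powDomain e lam s ∧ powApply e lam s z = y := by
  constructor
  · refine (hasSum_coord_sq e y).summable.congr fun k => ?_
    rw [h, mul_pow, rpow_sq_eq hl]
  · rw [powApply, ← (e.hasSum_repr y).tsum_eq]
    refine tsum_congr fun k => ?_
    rw [e.repr_apply_apply, ← h k, real_inner_comm]

theorem powDomain_sub (hl : ∀ k, 0 ≤ lam k) (hx : x ∈ powDomain e lam s)
    (hy : y ∈ powDomain e lam s) : x - y ∈ powDomain e lam s ∧
      powApply e lam s (x - y) = powApply e lam s x - powApply e lam s y :=
  mem_powDomain_and_powApply_eq hl fun k => by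
    rw [inner_sub_left, inner_sub_left, inner_powApply hl hx, inner_powApply hl hy]; ring

theorem powDomain_add (hl : ∀ k, 0 ≤ lam k) (hx : x ∈ powDomain e lam s)
    (hy : y ∈ powDomain e lam s) : x + y ∈ powDomain e lam s ∧
      powApply e lam s (x + y) = powApply e lam s x + powApply e lam s y :=
  mem_powDomain_and_powApply_eq hl fun k => by
    rw [inner_add_left, inner_add_left, inner_powApply hl hx, inner_powApply hl hy]; ring

theorem hasSum_norm_powApply_sq (hl : ∀ k, 0 ≤ lam k) (hz : z ∈ powDomain e lam s) :
    HasSum (fun k => lam k ^ (4 * s) * inner ℝ z (e k) ^ 2) (‖powApply e lam s z‖ ^ 2) := by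
  refine (hasSum_coord_sq e (powApply e lam s z)).congr_fun ?_
  intro k
  rw [inner_powApply hl hz, mul_pow, rpow_sq_eq hl]

theorem rpow_four_mul_half (r : ℝ) : r ^ (4 * (1 / 2 : ℝ)) = r ^ 2 := by
  rw [← Real.rpow_natCast]; norm_num

theorem rpow_four_mul_quarter (r : ℝ) : r ^ (4 * (1 / 4 : ℝ)) = r := by
  norm_num

theorem rpow_four_mul_three_quarters (r : ℝ) : r ^ (4 * (3 / 4 : ℝ)) = r ^ 3 := by
  rw [← Real.rpow_natCast]; norm_num

theorem rpow_four_mul_five_quarters (r : ℝ) : r ^ (4 * (5 / 4 : ℝ)) = r ^ 5 := by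
  rw [← Real.rpow_natCast]; norm_num

theorem rpow_two_mul_half (r : ℝ) : r ^ (2 * (1 / 2 : ℝ)) = r := by
  norm_num

theorem rpow_three_quarters_mul_quarter {r : ℝ} (hr : 0 ≤ r) :
    r ^ (2 * (3 / 4 : ℝ)) * r ^ (2 * (1 / 4 : ℝ)) = r ^ 2 := by
  rw [← Real.rpow_add' hr (by norm_num), ← Real.rpow_natCast]; norm_num

theorem half_of_three_quarters (hl : ∀ k, 0 ≤ lam k) (hz : z ∈ powDomain e lam (3 / 4)) :
    z ∈ powDomain e lam (1 / 2) := by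
  have h : Summable fun k => lam k ^ (4 * (3 / 4 : ℝ)) * inner ℝ z (e k) ^ 2 := hz
  simp only [rpow_four_mul_three_quarters] at h
  refine Summable.of_nonneg_of_le (fun k => by have := hl k; positivity) (fun k => ?_)
    ((hasSum_coord_sq e z).summable.add h)
  rw [rpow_four_mul_half]
  nlinarith [mul_nonneg (sq_nonneg (inner ℝ z (e k)))
    (by have := hl k; nlinarith [sq_nonneg (lam k - 1), mul_nonneg this (sq_nonneg (lam k - 1))] :
      0 ≤ 1 + lam k ^ 3 - lam k ^ 2)]

theorem quarter_of_three_quarters (hl : ∀ k, 0 ≤ lam k) (hz : z ∈ powDomain e lam (3 / 4)) :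
    z ∈ powDomain e lam (1 / 4) := by
  have h : Summable fun k => lam k ^ (4 * (3 / 4 : ℝ)) * inner ℝ z (e k) ^ 2 := hz
  simp only [rpow_four_mul_three_quarters] at h
  refine Summable.of_nonneg_of_le (fun k => by have := hl k; positivity) (fun k => ?_)
    ((hasSum_coord_sq e z).summable.add h)
  rw [rpow_four_mul_quarter]
  nlinarith [mul_nonneg (sq_nonneg (inner ℝ z (e k)))
    (by have := hl k; nlinarith [sq_nonneg (lam k - 1), mul_nonneg this (sq_nonneg (lam k - 1))] :
      0 ≤ 1 + lam k ^ 3 - lam k)]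

theorem hasSum_norm_half_sq (hl : ∀ k, 0 ≤ lam k) (hz : z ∈ powDomain e lam (3 / 4)) :
    HasSum (fun k => lam k ^ 2 * inner ℝ z (e k) ^ 2) (‖powApply e lam (1 / 2) z‖ ^ 2) := by
  simpa only [rpow_four_mul_half] using
    hasSum_norm_powApply_sq hl (half_of_three_quarters hl hz)

/-- The energy as a sum over the modes. -/
theorem hasSum_kirchhoffEnergy (hl : ∀ k, 0 ≤ lam k) (hx : x ∈ powDomain e lam (3 / 4))
    (hy : y ∈ powDomain e lam (1 / 4)) :
    HasSum (fun k => (1 + lam k) * (inner ℝ y (e k) ^ 2 + lam k ^ 2 * inner ℝ x (e k) ^ 2))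
      (kirchhoffEnergy e lam x y) := by
  have h1 := hasSum_norm_powApply_sq hl hy
  have h2 := hasSum_norm_powApply_sq hl hx
  simp only [rpow_four_mul_three_quarters, rpow_four_mul_quarter] at h1 h2
  refine ((((hasSum_coord_sq e y).add h1).add (hasSum_norm_half_sq hl hx)).add h2).congr_fun ?_
  intro k; ring

theorem kirchhoffEnergy_nonneg (e : HilbertBasis ι ℝ H) (lam : ι → ℝ) (x y : H) :
    0 ≤ kirchhoffEnergy e lam x y := by
  unfold kirchhoffEnergy; positivity

theorem kirchhoffEnergy_sub_le (hl : ∀ k, 0 ≤ lam k) {x' y' : H}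
    (hx : x ∈ powDomain e lam (3 / 4)) (hy : y ∈ powDomain e lam (1 / 4))
    (hx' : x' ∈ powDomain e lam (3 / 4)) (hy' : y' ∈ powDomain e lam (1 / 4)) :
    kirchhoffEnergy e lam (x - x') (y - y') ≤
      2 * kirchhoffEnergy e lam x y + 2 * kirchhoffEnergy e lam x' y' := by
  refine hasSum_le (fun k => ?_) (hasSum_kirchhoffEnergy hl (powDomain_sub hl hx hx').1
    (powDomain_sub hl hy hy').1) (((hasSum_kirchhoffEnergy hl hx hy).mul_left 2).add
      ((hasSum_kirchhoffEnergy hl hx' hy').mul_left 2))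
  have h1 : 0 ≤ 1 + lam k := by linarith [hl k]
  rw [inner_sub_left, inner_sub_left]
  nlinarith [mul_nonneg h1 (sq_nonneg (inner ℝ y (e k) + inner ℝ y' (e k))),
    mul_nonneg h1 (mul_nonneg (sq_nonneg (lam k))
      (sq_nonneg (inner ℝ x (e k) + inner ℝ x' (e k))))]

theorem kirchhoffEnergy_le_sub (hl : ∀ k, 0 ≤ lam k) {x' y' : H}
    (hx : x ∈ powDomain e lam (3 / 4)) (hy : y ∈ powDomain e lam (1 / 4))
    (hx' : x' ∈ powDomain e lam (3 / 4)) (hy' : y' ∈ powDomain e lam (1 / 4)) :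
    kirchhoffEnergy e lam x y ≤
      2 * kirchhoffEnergy e lam (x - x') (y - y') + 2 * kirchhoffEnergy e lam x' y' := by
  refine hasSum_le (fun k => ?_) (hasSum_kirchhoffEnergy hl hx hy)
    (((hasSum_kirchhoffEnergy hl (powDomain_sub hl hx hx').1
    (powDomain_sub hl hy hy').1).mul_left 2).add
      ((hasSum_kirchhoffEnergy hl hx' hy').mul_left 2))
  have h1 : 0 ≤ 1 + lam k := by linarith [hl k]
  rw [inner_sub_left, inner_sub_left]
  nlinarith [mul_nonneg h1 (sq_nonneg (inner ℝ y (e k) - 2 * inner ℝ y' (e k))),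
    mul_nonneg h1 (mul_nonneg (sq_nonneg (lam k))
      (sq_nonneg (inner ℝ x (e k) - 2 * inner ℝ x' (e k))))]

theorem kirchhoffEnergy_sub_comm (hl : ∀ k, 0 ≤ lam k) {x' y' : H}
    (hx : x ∈ powDomain e lam (3 / 4)) (hy : y ∈ powDomain e lam (1 / 4))
    (hx' : x' ∈ powDomain e lam (3 / 4)) (hy' : y' ∈ powDomain e lam (1 / 4)) :
    kirchhoffEnergy e lam (x - x') (y - y') = kirchhoffEnergy e lam (x' - x) (y' - y) := by
  refine (hasSum_kirchhoffEnergy hl (powDomain_sub hl hx hx').1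
    (powDomain_sub hl hy hy').1).unique ((hasSum_kirchhoffEnergy hl (powDomain_sub hl hx' hx).1
    (powDomain_sub hl hy' hy).1).congr_fun fun k => ?_)
  simp only [inner_sub_left]; ring

/-- On coordinates this is `λ · λ = λ^{3/2} · λ^{1/2}`. It trades the power `1/2` for the powers
`3/4` and `1/4`, in which the solution class provides continuity and differentiability. -/
theorem inner_half_half (hl : ∀ k, 0 ≤ lam k) (hx : x ∈ powDomain e lam (3 / 4))
    (hy : y ∈ powDomain e lam (3 / 4)) :
    inner ℝ (powApply e lam (1 / 2) x) (powApply e lam (1 / 2) y) =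
      inner ℝ (powApply e lam (3 / 4) x) (powApply e lam (1 / 4) y) := by
  refine (hasSum_coord_mul_coord e _ _).unique
    ((hasSum_coord_mul_coord e (powApply e lam (3 / 4) x) (powApply e lam (1 / 4) y)).congr_fun
      fun k => ?_)
  rw [inner_powApply hl hx, inner_powApply hl (quarter_of_three_quarters hl hy),
    inner_powApply hl (half_of_three_quarters hl hx),
    inner_powApply hl (half_of_three_quarters hl hy), rpow_two_mul_half]
  linear_combination (-inner ℝ x (e k) * inner ℝ y (e k)) *
    rpow_three_quarters_mul_quarter (hl k)

end Coordinates

/-! ### Modal solutions: regularity in time and equivalence with weak solutions. -/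

/-- A solution of the Kirchhoff equation, with the equation expressed mode by mode. -/
structure IsModalSolution {ι H : Type*} [NormedAddCommGroup H] [InnerProductSpace ℝ H]
    (e : HilbertBasis ι ℝ H) (lam : ι → ℝ) (m : ℝ → ℝ) (T : ℝ) (u v : ℝ → H) : Prop where
  pos_continuous : IsC0InPow e lam (3 / 4) T u
  vel_continuous : IsC0InPow e lam (1 / 4) T v
  modes : IsModeSolution lam T (fun t => m (‖powApply e lam (1 / 2) (u t)‖ ^ 2))
    (fun k t => inner ℝ (u t) (e k)) (fun k t => inner ℝ (v t) (e k))

/-- An energy bound `R` confines `|A^{1/2}u|²` to the compact interval `[0,R]`, on which `m` and its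
one-sided derivative are bounded. -/
theorem exists_bounds_of_contDiffOn {m : ℝ → ℝ} (hm : ContDiffOn ℝ 1 m (Ici 0)) (R : ℝ) :
    ∃ M L : ℝ, 0 ≤ M ∧ 0 ≤ L ∧ (∀ σ ∈ Icc 0 R, m σ ≤ M) ∧
      (∀ σ ∈ Icc 0 R, HasDerivWithinAt m (derivWithin m (Ici 0) σ) (Ici 0) σ ∧
        |derivWithin m (Ici 0) σ| ≤ L) ∧
      ∀ σ ∈ Icc 0 R, ∀ τ ∈ Icc 0 R, |m σ - m τ| ≤ L * |σ - τ| := by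
  have hsub : Icc (0 : ℝ) R ⊆ Ici 0 := fun x hx => hx.1
  obtain ⟨M, hM⟩ := isCompact_Icc.exists_bound_of_continuousOn (hm.continuousOn.mono hsub)
  obtain ⟨L, hL⟩ := isCompact_Icc.exists_bound_of_continuousOn
    ((hm.continuousOn_derivWithin (uniqueDiffOn_Ici 0) le_rfl).mono hsub)
  have hder : ∀ σ ∈ Icc 0 R, HasDerivWithinAt m (derivWithin m (Ici 0) σ) (Ici 0) σ :=
    fun σ hσ => ((hm.differentiableOn one_ne_zero) σ hσ.1).hasDerivWithinAt
  have hL' : ∀ σ ∈ Icc 0 R, ‖derivWithin m (Ici 0) σ‖ ≤ max L 0 := fun σ hσ =>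
    (hL σ hσ).trans (le_max_left _ _)
  refine ⟨max M 0, max L 0, le_max_right _ _, le_max_right _ _, fun σ hσ =>
    ((le_abs_self _).trans (hM σ hσ)).trans (le_max_left _ _),
    fun σ hσ => ⟨hder σ hσ, hL' σ hσ⟩, fun σ hσ τ hτ => ?_⟩
  exact (convex_Icc 0 R).norm_image_sub_le_of_norm_hasDerivWithin_le
    (fun x hx => (hder x hx).mono hsub) hL' hτ hσ

section

variable {ι H : Type*} [NormedAddCommGroup H] [InnerProductSpace ℝ H] {e : HilbertBasis ι ℝ H}
  {lam : ι → ℝ} {m : ℝ → ℝ} {T : ℝ} {u v : ℝ → H}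

theorem IsC0InPow.continuousOn {s : ℝ} {f : ℝ → H} (h : IsC0InPow e lam s T f) :
    ContinuousOn f (Icc 0 T) := fun t ht => (h.2 t ht).1

theorem IsC0InPow.continuousOn_powApply {s : ℝ} {f : ℝ → H} (h : IsC0InPow e lam s T f) :
    ContinuousOn (fun t => powApply e lam s (f t)) (Icc 0 T) := fun t ht => (h.2 t ht).2

theorem IsC0InPow.mono {s T' : ℝ} {f : ℝ → H} (h : IsC0InPow e lam s T f) (hT : T' ≤ T) :
    IsC0InPow e lam s T' f :=
  have hs : Icc 0 T' ⊆ Icc 0 T := Icc_subset_Icc_right hT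
  ⟨fun t ht => h.1 t (hs ht), fun t ht => ⟨(h.continuousOn.mono hs) t ht,
    (h.continuousOn_powApply.mono hs) t ht⟩⟩

theorem IsModalSolution.mono {T' : ℝ} (h : IsModalSolution e lam m T u v) (hT : T' ≤ T) :
    IsModalSolution e lam m T' u v :=
  have hs : Icc 0 T' ⊆ Icc 0 T := Icc_subset_Icc_right hT
  ⟨h.pos_continuous.mono hT, h.vel_continuous.mono hT,
    fun k t ht => (h.modes.pos k t (hs ht)).mono hs,
    fun k t ht => (h.modes.vel k t (hs ht)).mono hs⟩

/-- A function with continuous weak derivative (tested on a Hilbert basis) is differentiable. -/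
theorem hasDerivWithinAt_of_coord [CompleteSpace H] (e : HilbertBasis ι ℝ H) {f g : ℝ → H}
    (hg : ContinuousOn g (Icc 0 T))
    (h : ∀ k, ∀ t ∈ Icc 0 T, HasDerivWithinAt (fun r => inner ℝ (f r) (e k))
      (inner ℝ (g t) (e k)) (Icc 0 T) t) {t : ℝ} (ht : t ∈ Icc 0 T) :
    HasDerivWithinAt f (g t) (Icc 0 T) t := by
  have key : ∀ r ∈ Icc 0 T, f r = f 0 + ∫ x in (0 : ℝ)..r, g x := fun r hr => by
    refine ext_coord e fun k => ?_
    rw [eq_add_integral_of_hasDerivWithinAt (h k) (hg.inner continuousOn_const) hr,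
      inner_add_left, real_inner_comm]
    congr 1
    have hi : IntervalIntegrable g MeasureTheory.volume 0 r :=
      (hg.mono (Icc_subset_Icc_right hr.2)).intervalIntegrable_of_Icc hr.1
    have := (innerSL ℝ (e k)).intervalIntegral_comp_comm hi
    simp only [innerSL_apply_apply] at this
    rw [real_inner_comm, ← this]
    exact intervalIntegral.integral_congr fun x _ => real_inner_comm _ _
  exact ((hasDerivWithinAt_integral_Icc hg ht).const_add (f 0)).congr key (key t ht)

/-- The test vectors `φ = e_k` lie in `D(A)` and are eigenvectors, which turns the weak equation
into an ordinary one per mode. -/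
theorem IsKirchhoffSolution.isModalSolution [CompleteSpace H] {A : H →ₗ.[ℝ] H}
    (hA : IsDiagonalSelfAdjoint A e lam) {u₀ u₁ : H}
    (h : IsKirchhoffSolution A e lam m T u₀ u₁ u v) : IsModalSolution e lam m T u v := by
  refine ⟨h.continuous, h.differentiable.2.2.2, fun k t ht => ?_, fun k t ht => ?_⟩
  · simpa using (h.differentiable.2.1 t ht).inner ℝ
      (hasDerivWithinAt_const (c := e k) (s := Icc 0 T) (x := t))
  · obtain ⟨hk, hAk⟩ := hA.eigen k
    have := h.equation ⟨e k, hk⟩ t ht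
    rwa [hAk, inner_smul_right] at this

/-- Each coordinate of `A^{1/4}u` is a multiple of a mode, and `A^{1/4}v` is continuous by
assumption, so differentiability in `H` follows. The `C¹` clause of the solution class is therefore
automatic for modal solutions. -/
theorem IsModalSolution.hasDerivWithinAt_quarter [CompleteSpace H] (hl : ∀ k, 0 ≤ lam k)
    (h : IsModalSolution e lam m T u v) {t : ℝ} (ht : t ∈ Icc 0 T) :
    HasDerivWithinAt (fun r => powApply e lam (1 / 4) (u r)) (powApply e lam (1 / 4) (v t))
      (Icc 0 T) t := by
  have hmem : ∀ r ∈ Icc 0 T, u r ∈ powDomain e lam (1 / 4) := fun r hr =>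
    quarter_of_three_quarters hl (h.pos_continuous.1 r hr)
  refine hasDerivWithinAt_of_coord e (f := fun r => powApply e lam (1 / 4) (u r))
    (g := fun r => powApply e lam (1 / 4) (v r))
    h.vel_continuous.continuousOn_powApply (fun k r hr => ?_) ht
  rw [inner_powApply hl (h.vel_continuous.1 r hr)]
  exact ((h.modes.pos k r hr).const_mul _).congr (fun x hx => inner_powApply hl (hmem x hx) k)
    (inner_powApply hl (hmem r hr) k)

/-- `A^{1/2}u` need not be differentiable in `H`, but the increment of its squared norm equals
`⟨A^{3/4}(u(r)+u(t)), A^{1/4}(u(r)-u(t))⟩`. Here the first factor is continuous and the second,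
divided by `r - t`, converges. -/
theorem IsModalSolution.hasDerivWithinAt_half_sq [CompleteSpace H] (hl : ∀ k, 0 ≤ lam k)
    (h : IsModalSolution e lam m T u v) {t : ℝ} (ht : t ∈ Icc 0 T) :
    HasDerivWithinAt (fun r => ‖powApply e lam (1 / 2) (u r)‖ ^ 2)
      (2 * inner ℝ (powApply e lam (3 / 4) (u t)) (powApply e lam (1 / 4) (v t)))
      (Icc 0 T) t := by
  have hq := h.hasDerivWithinAt_quarter hl ht
  rw [hasDerivWithinAt_iff_tendsto_slope] at hq ⊢
  have h3 : Tendsto (fun r => powApply e lam (3 / 4) (u r)) (𝓝[Icc 0 T \ {t}] t)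
      (𝓝 (powApply e lam (3 / 4) (u t))) :=
    (h.pos_continuous.continuousOn_powApply t ht).mono_left (nhdsWithin_mono _ sdiff_subset)
  have hlim := (h3.add_const (powApply e lam (3 / 4) (u t))).inner (𝕜 := ℝ) hq
  rw [← two_smul ℝ (powApply e lam (3 / 4) (u t)), inner_smul_left] at hlim
  simp only [conj_trivial] at hlim
  refine hlim.congr' (eventually_nhdsWithin_of_forall fun r hr => ?_)
  have hur := h.pos_continuous.1 r hr.1
  have hut := h.pos_continuous.1 t ht
  have ha := powDomain_add hl hur hut
  have hs := powDomain_sub hl hur hut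
  have hsq := powDomain_sub hl (quarter_of_three_quarters hl hur)
    (quarter_of_three_quarters hl hut)
  have hah := powDomain_add hl (half_of_three_quarters hl hur) (half_of_three_quarters hl hut)
  have hsh := powDomain_sub hl (half_of_three_quarters hl hur) (half_of_three_quarters hl hut)
  have := inner_half_half hl ha.1 hs.1
  rw [ha.2, hsq.2, hah.2, hsh.2] at this
  simp only [slope_def_module, inner_smul_right, ← this, smul_eq_mul]
  rw [inner_add_left, inner_sub_right, inner_sub_right, real_inner_self_eq_norm_sq,
    real_inner_self_eq_norm_sq, real_inner_comm (powApply e lam (1 / 2) (u r))]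
  ring

/-- For general `φ ∈ D(A)` the modal equations cannot simply be summed under the derivative.
Integrated in time they become an identity between coordinates of `v(t)`, `v(0)` and `W(t) = ∫ m u`,
a vector of `H`. Parseval yields `⟨v(t),φ⟩ = ⟨v(0),φ⟩ - ⟨W(t),Aφ⟩`, which is then differentiated. -/
theorem IsModalSolution.isKirchhoffSolution [CompleteSpace H] {A : H →ₗ.[ℝ] H}
    (hA : IsDiagonalSelfAdjoint A e lam) (hm : ContinuousOn m (Ici 0))
    (h : IsModalSolution e lam m T u v) :
    IsKirchhoffSolution A e lam m T (u 0) (v 0) u v := by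
  have hl := hA.lam_nonneg
  have hc : ContinuousOn (fun t => ‖powApply e lam (1 / 2) (u t)‖ ^ 2) (Icc 0 T) := fun t ht =>
    (h.hasDerivWithinAt_half_sq hl ht).continuousWithinAt
  refine ⟨h.pos_continuous, ⟨fun t ht => quarter_of_three_quarters hl (h.pos_continuous.1 t ht),
    fun t ht => hasDerivWithinAt_of_coord e h.vel_continuous.continuousOn h.modes.pos ht,
    fun t ht => h.hasDerivWithinAt_quarter hl ht, h.vel_continuous⟩, rfl, rfl, ?_⟩
  intro φ t ht
  -- Self-adjointness enters through the symmetry `⟨Aφ, e_k⟩ = ⟨φ, Ae_k⟩`.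
  have hφ : ∀ k, inner ℝ (A φ) (e k) = lam k ^ 2 * inner ℝ (φ : H) (e k) := fun k => by
    obtain ⟨hk, hAk⟩ := hA.eigen k
    have hsymm : A.IsFormalAdjoint A := by
      have := LinearPMap.adjoint_isFormalAdjoint hA.dense_domain
      rwa [show A.adjoint = A from hA.selfAdjoint] at this
    have := hsymm φ ⟨e k, hk⟩
    rw [this, hAk, inner_smul_right]
  have hcc : ContinuousOn (fun t => m (‖powApply e lam (1 / 2) (u t)‖ ^ 2)) (Icc 0 T) :=
    hm.comp hc fun t _ => mem_Ici.2 (sq_nonneg _)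
  have hcu : ContinuousOn (fun t => m (‖powApply e lam (1 / 2) (u t)‖ ^ 2) • u t) (Icc 0 T) :=
    hcc.smul h.pos_continuous.continuousOn
  set W : ℝ → H := fun r => ∫ x in (0 : ℝ)..r, m (‖powApply e lam (1 / 2) (u x)‖ ^ 2) • u x
    with hW
  have hWd : ∀ r ∈ Icc 0 T, HasDerivWithinAt W
      (m (‖powApply e lam (1 / 2) (u r)‖ ^ 2) • u r) (Icc 0 T) r := fun r hr =>
    hasDerivWithinAt_integral_Icc hcu hr
  have hcoord : ∀ k, ∀ r ∈ Icc 0 T,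
      inner ℝ (v r) (e k) = inner ℝ (v 0) (e k) - lam k ^ 2 * inner ℝ (W r) (e k) := by
    intro k r hr
    have h1 := eq_add_integral_of_hasDerivWithinAt (h.modes.vel k)
      (hcc.mul ((h.pos_continuous.continuousOn.inner continuousOn_const).const_mul _)).neg hr
    have h2 : ∀ r ∈ Icc 0 T, HasDerivWithinAt (fun r => -(lam k ^ 2 * inner ℝ (W r) (e k)))
        (-(m (‖powApply e lam (1 / 2) (u r)‖ ^ 2) * (lam k ^ 2 * inner ℝ (u r) (e k))))
        (Icc 0 T) r := fun r hr => by
      refine ((((hWd r hr).inner ℝ (hasDerivWithinAt_const (c := e k) (s := Icc 0 T)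
        (x := r))).const_mul (lam k ^ 2)).neg).congr_deriv ?_
      simp [inner_smul_left]; ring
    have h3 := eq_add_integral_of_hasDerivWithinAt h2
      (hcc.mul ((h.pos_continuous.continuousOn.inner continuousOn_const).const_mul _)).neg hr
    have h4 : W 0 = 0 := by simp [hW]
    rw [h4, inner_zero_left, mul_zero, neg_zero, zero_add] at h3
    rw [h1, ← h3]; ring
  have heq : ∀ r ∈ Icc 0 T, inner ℝ (v r) (φ : H) = inner ℝ (v 0) (φ : H) - inner ℝ (W r) (A φ) :=
    fun r hr => by
      refine (hasSum_coord_mul_coord e _ _).unique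
        (((hasSum_coord_mul_coord e (v 0) (φ : H)).sub
          (hasSum_coord_mul_coord e (W r) (A φ))).congr_fun fun k => ?_)
      rw [hcoord k r hr, hφ]; ring
  refine HasDerivWithinAt.congr_deriv (((((hWd t ht).inner ℝ (hasDerivWithinAt_const (c := A φ)
    (s := Icc 0 T) (x := t))).const_sub (inner ℝ (v 0) (φ : H)))).congr heq (heq t ht)) ?_
  simp [inner_smul_left]

/-- With the power `1/2` eliminated, continuity of the energy in time follows from that of
`A^{1/4}u`, `A^{3/4}u`, `v` and `A^{1/4}v`. -/
theorem kirchhoffEnergy_eq (hl : ∀ k, 0 ≤ lam k) {x : H} (y : H)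
    (hx : x ∈ powDomain e lam (3 / 4)) :
    kirchhoffEnergy e lam x y = ‖y‖ ^ 2 + ‖powApply e lam (1 / 4) y‖ ^ 2 +
      inner ℝ (powApply e lam (3 / 4) x) (powApply e lam (1 / 4) x)
        + ‖powApply e lam (3 / 4) x‖ ^ 2 := by
  rw [← inner_half_half hl hx hx, real_inner_self_eq_norm_sq, kirchhoffEnergy]

theorem IsModalSolution.continuousOn_energy [CompleteSpace H] (hl : ∀ k, 0 ≤ lam k)
    (h : IsModalSolution e lam m T u v) :
    ContinuousOn (fun t => kirchhoffEnergy e lam (u t) (v t)) (Icc 0 T) := by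
  have hq : ContinuousOn (fun t => powApply e lam (1 / 4) (u t)) (Icc 0 T) := fun t ht =>
    (h.hasDerivWithinAt_quarter hl ht).continuousWithinAt
  refine ContinuousOn.congr ?_ fun t ht => kirchhoffEnergy_eq hl (v t) (h.pos_continuous.1 t ht)
  have h1 := h.vel_continuous.continuousOn
  have h2 := h.vel_continuous.continuousOn_powApply
  have h3 := h.pos_continuous.continuousOn_powApply
  exact (((h1.norm.pow 2).add (h2.norm.pow 2)).add (h3.inner hq)).add (h3.norm.pow 2)

theorem IsModalSolution.continuousOn_energy_sub [CompleteSpace H] (hl : ∀ k, 0 ≤ lam k)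
    {y z : ℝ → H} (h : IsModalSolution e lam m T u v) (h' : IsModalSolution e lam m T y z) :
    ContinuousOn (fun t => kirchhoffEnergy e lam (y t - u t) (z t - v t)) (Icc 0 T) := by
  have hq : ContinuousOn (fun t => powApply e lam (1 / 4) (u t)) (Icc 0 T) := fun t ht =>
    (h.hasDerivWithinAt_quarter hl ht).continuousWithinAt
  have hq' : ContinuousOn (fun t => powApply e lam (1 / 4) (y t)) (Icc 0 T) := fun t ht =>
    (h'.hasDerivWithinAt_quarter hl ht).continuousWithinAt
  have h1 := h'.vel_continuous.continuousOn.sub h.vel_continuous.continuousOn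
  have h2 := h'.vel_continuous.continuousOn_powApply.sub h.vel_continuous.continuousOn_powApply
  have h3 := h'.pos_continuous.continuousOn_powApply.sub h.pos_continuous.continuousOn_powApply
  refine ContinuousOn.congr ((((h1.norm.pow 2).add (h2.norm.pow 2)).add
    (h3.inner (𝕜 := ℝ) (hq'.sub hq))).add (h3.norm.pow 2)) fun t ht => ?_
  have hu := h.pos_continuous.1 t ht
  have hy := h'.pos_continuous.1 t ht
  rw [kirchhoffEnergy_eq hl _ (powDomain_sub hl hy hu).1, (powDomain_sub hl hy hu).2,
    (powDomain_sub hl (h'.vel_continuous.1 t ht) (h.vel_continuous.1 t ht)).2,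
    (powDomain_sub hl (quarter_of_three_quarters hl hy) (quarter_of_three_quarters hl hu)).2]
  rfl

theorem IsModalSolution.exists_energy_le [CompleteSpace H] (hl : ∀ k, 0 ≤ lam k)
    (h : IsModalSolution e lam m T u v) :
    ∃ R : ℝ, 0 ≤ R ∧ ∀ t ∈ Icc 0 T, kirchhoffEnergy e lam (u t) (v t) ≤ R := by
  obtain ⟨R, hR⟩ := isCompact_Icc.exists_bound_of_continuousOn (h.continuousOn_energy hl)
  exact ⟨max R 0, le_max_right _ _, fun t ht =>
    ((le_abs_self _).trans (hR t ht)).trans (le_max_left _ _)⟩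

theorem norm_half_sq_le_kirchhoffEnergy (e : HilbertBasis ι ℝ H) (lam : ι → ℝ) (x y : H) :
    ‖powApply e lam (1 / 2) x‖ ^ 2 ≤ kirchhoffEnergy e lam x y := by
  have h1 := sq_nonneg ‖y‖
  have h2 := sq_nonneg ‖powApply e lam (1 / 4) y‖
  have h3 := sq_nonneg ‖powApply e lam (3 / 4) x‖
  unfold kirchhoffEnergy; linarith

/-- By the chain rule `c' = m'(|A^{1/2}u|²) · 2⟨A^{3/4}u, A^{1/4}v⟩`, and the second factor is at
most `|A^{3/4}u|² + |A^{1/4}v|² ≤ E ≤ R`. This is what makes `D(A^{3/4}) × D(A^{1/4})` the right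
space. -/
theorem IsModalSolution.isSpeed [CompleteSpace H] (hl : ∀ k, 0 ≤ lam k) {ν₀ R M L : ℝ}
    (hmν : ∀ σ, 0 ≤ σ → ν₀ ≤ m σ) (hL : 0 ≤ L) (hM : ∀ σ ∈ Icc 0 R, m σ ≤ M)
    (hmL : ∀ σ ∈ Icc 0 R, HasDerivWithinAt m (derivWithin m (Ici 0) σ) (Ici 0) σ ∧
        |derivWithin m (Ici 0) σ| ≤ L)
    (h : IsModalSolution e lam m T u v)
    (hR : ∀ t ∈ Icc 0 T, kirchhoffEnergy e lam (u t) (v t) ≤ R) :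
    IsSpeed T ν₀ M (L * R) (fun t => m (‖powApply e lam (1 / 2) (u t)‖ ^ 2)) := by
  have hσ : ∀ t ∈ Icc 0 T, ‖powApply e lam (1 / 2) (u t)‖ ^ 2 ∈ Icc 0 R := fun t ht =>
    ⟨sq_nonneg _, (norm_half_sq_le_kirchhoffEnergy e lam _ _).trans (hR t ht)⟩
  refine ⟨fun t _ => hmν _ (sq_nonneg _), fun t ht => hM _ (hσ t ht), _, fun t ht =>
    ⟨((hmL _ (hσ t ht)).1.comp t (h.hasDerivWithinAt_half_sq hl ht)
      fun r _ => sq_nonneg (‖powApply e lam (1 / 2) (u r)‖)), ?_⟩⟩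
  rw [abs_mul]
  refine mul_le_mul (hmL _ (hσ t ht)).2 ?_ (abs_nonneg _) hL
  refine le_trans ?_ (hR t ht)
  rw [abs_mul, abs_two]
  have h1 := abs_real_inner_le_norm (powApply e lam (3 / 4) (u t)) (powApply e lam (1 / 4) (v t))
  have h2 := sq_nonneg (‖powApply e lam (3 / 4) (u t)‖ - ‖powApply e lam (1 / 4) (v t)‖)
  have h3 := sq_nonneg ‖v t‖
  have h4 := sq_nonneg ‖powApply e lam (1 / 2) (u t)‖
  unfold kirchhoffEnergy; nlinarith

end

/-! ### Comparison of two solutions. -/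

section

variable {ι H : Type*} [NormedAddCommGroup H] [InnerProductSpace ℝ H] {e : HilbertBasis ι ℝ H}
  {lam : ι → ℝ} {m : ℝ → ℝ} {T : ℝ} {u v y z : ℝ → H}

theorem sum_modes_le_energy (hl : ∀ k, 0 ≤ lam k) {a b : H} (ha : a ∈ powDomain e lam (3 / 4))
    (hb : b ∈ powDomain e lam (1 / 4)) (s : Finset ι) :
    ∑ k ∈ s, (1 + lam k) * (inner ℝ b (e k) ^ 2 + lam k ^ 2 * inner ℝ a (e k) ^ 2) ≤
      kirchhoffEnergy e lam a b :=
  sum_le_hasSum s (fun k _ => by have := hl k; positivity) (hasSum_kirchhoffEnergy hl ha hb)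

theorem sum_pos_modes_le_energy (hl : ∀ k, 0 ≤ lam k) {a b : H}
    (ha : a ∈ powDomain e lam (3 / 4)) (hb : b ∈ powDomain e lam (1 / 4)) (s : Finset ι) :
    ∑ k ∈ s, (1 + lam k) * (lam k ^ 2 * inner ℝ a (e k) ^ 2) ≤ kirchhoffEnergy e lam a b := by
  refine le_trans (Finset.sum_le_sum fun k _ => ?_) (sum_modes_le_energy hl ha hb s)
  have := hl k
  exact mul_le_mul_of_nonneg_left (by linarith [sq_nonneg (inner ℝ b (e k))]) (by linarith)

/-- The difference of `|A^{1/2} ·|²` is controlled by any sufficiently strong weighted norm of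
the difference. -/
theorem sq_sub_norm_half_sq_le (hl : ∀ k, 0 ≤ lam k) {a a' b b' : H} {R g : ℝ} {ω : ι → ℝ}
    (ha : a ∈ powDomain e lam (3 / 4)) (hb : b ∈ powDomain e lam (1 / 4))
    (ha' : a' ∈ powDomain e lam (3 / 4)) (hb' : b' ∈ powDomain e lam (1 / 4))
    (hR : kirchhoffEnergy e lam a b ≤ R) (hR' : kirchhoffEnergy e lam a' b' ≤ R)
    (hω : ∀ k, 0 ≤ ω k) (hω1 : ∀ k, 1 ≤ ω k * (1 + lam k))
    (hg : ∀ s : Finset ι,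
      ∑ k ∈ s, ω k * (lam k ^ 2 * (inner ℝ a' (e k) - inner ℝ a (e k)) ^ 2) ≤ g) :
    (‖powApply e lam (1 / 2) a'‖ ^ 2 - ‖powApply e lam (1 / 2) a‖ ^ 2) ^ 2 ≤ 4 * R * g := by
  have hlim := ((hasSum_norm_half_sq hl ha').sub (hasSum_norm_half_sq hl ha)).pow 2
  refine le_of_tendsto hlim (Eventually.of_forall fun s => ?_)
  have hg0 : 0 ≤ g := by simpa using hg ∅
  -- Cauchy–Schwarz on `λ²(a'² - a²) = λ²(a'+a) · (a'-a)`: the sum takes the weight `1 + λ` and is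
  -- bounded by the energies, the difference takes `ω`. The condition `1 ≤ ω(1+λ)` makes the product
  -- of the weights sufficient.
  have hcs := Finset.sum_sq_le_sum_mul_sum_of_sq_le_mul s
    (r := fun k => lam k ^ 2 * inner ℝ a' (e k) ^ 2 - lam k ^ 2 * inner ℝ a (e k) ^ 2)
    (f := fun k => (1 + lam k) * (lam k ^ 2 * (inner ℝ a' (e k) + inner ℝ a (e k)) ^ 2))
    (g := fun k => ω k * (lam k ^ 2 * (inner ℝ a' (e k) - inner ℝ a (e k)) ^ 2))
    (fun k _ => by have := hl k; positivity) (fun k _ => mul_nonneg (hω k) (by positivity))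
    (fun k _ => by
      have h0 : 0 ≤ (lam k ^ 2 * (inner ℝ a' (e k) + inner ℝ a (e k))
        * (inner ℝ a' (e k) - inner ℝ a (e k))) ^ 2 := sq_nonneg _
      nlinarith [mul_le_mul_of_nonneg_right (hω1 k) h0])
  refine hcs.trans (mul_le_mul ?_ (hg s) (Finset.sum_nonneg fun k _ =>
    mul_nonneg (hω k) (by positivity)) ?_)
  · calc _ ≤ ∑ k ∈ s, (2 * ((1 + lam k) * (lam k ^ 2 * inner ℝ a' (e k) ^ 2))
          + 2 * ((1 + lam k) * (lam k ^ 2 * inner ℝ a (e k) ^ 2))) := by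
          refine Finset.sum_le_sum fun k _ => ?_
          have h1 : 0 ≤ (1 + lam k) * lam k ^ 2 := by have := hl k; positivity
          nlinarith [mul_nonneg h1 (sq_nonneg (inner ℝ a' (e k) - inner ℝ a (e k)))]
      _ = 2 * ∑ k ∈ s, (1 + lam k) * (lam k ^ 2 * inner ℝ a' (e k) ^ 2)
          + 2 * ∑ k ∈ s, (1 + lam k) * (lam k ^ 2 * inner ℝ a (e k) ^ 2) := by
          rw [Finset.sum_add_distrib, Finset.mul_sum, Finset.mul_sum]
      _ ≤ _ := by
          have h1 := sum_pos_modes_le_energy hl ha hb s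
          have h2 := sum_pos_modes_le_energy hl ha' hb' s
          linarith
  · have := kirchhoffEnergy_nonneg e lam a b
    linarith

/-- Lipschitz dependence on the initial data in weighted energy norms. -/
theorem exists_weighted_lipschitz [CompleteSpace H] (e : HilbertBasis ι ℝ H)
    (hl : ∀ k, 0 ≤ lam k) (hm : ContDiffOn ℝ 1 m (Ici 0)) {ν₀ : ℝ} (hν₀ : 0 < ν₀)
    (hmν : ∀ σ, 0 ≤ σ → ν₀ ≤ m σ) {R B : ℝ} (hR : 0 ≤ R) (hB : 0 ≤ B) (T : ℝ) :
    ∃ C : ℝ, 0 ≤ C ∧ ∀ (ω : ι → ℝ) (T' : ℝ) (u v y z : ℝ → H), T' ≤ T →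
      (∀ k, 0 ≤ ω k) → (∀ k, 1 ≤ ω k * (1 + lam k)) →
      IsModalSolution e lam m T' u v → IsModalSolution e lam m T' y z →
      (∀ t ∈ Icc 0 T', kirchhoffEnergy e lam (u t) (v t) ≤ R) →
      (∀ t ∈ Icc 0 T', kirchhoffEnergy e lam (y t) (z t) ≤ R) →
      (∀ s : Finset ι, ∀ t ∈ Icc 0 T',
        ∑ k ∈ s, ω k * (lam k ^ 4 * inner ℝ (u t) (e k) ^ 2) ≤ B) →
      ∀ G : ℝ, (∀ s : Finset ι, ∑ k ∈ s, ω k * (inner ℝ (z 0 - v 0) (e k) ^ 2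
        + lam k ^ 2 * inner ℝ (y 0 - u 0) (e k) ^ 2) ≤ G) →
      ∀ t ∈ Icc 0 T', ∀ s : Finset ι, ∑ k ∈ s, ω k * (inner ℝ (z t - v t) (e k) ^ 2
        + lam k ^ 2 * inner ℝ (y t - u t) (e k) ^ 2) ≤ C * G := by
  obtain ⟨M, L, hM0, hL0, hM, hder, hLip⟩ := exists_bounds_of_contDiffOn hm R
  obtain ⟨C, hC, hmain⟩ := IsModeSolution.exists_sum_sub_le (ι := ι) (D := L ^ 2 * (4 * R)) hν₀ hM0
    (mul_nonneg hL0 hR) hB (by positivity) T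
  refine ⟨C, hC, ?_⟩
  intro ω T' u v y z hT hω hω1 h h' hER hER' hBu G hG t ht s
  simp only [inner_sub_left] at hG ⊢
  have hσ : ∀ {u v : ℝ → H}, (∀ t ∈ Icc 0 T', kirchhoffEnergy e lam (u t) (v t) ≤ R) →
      ∀ t ∈ Icc 0 T', ‖powApply e lam (1 / 2) (u t)‖ ^ 2 ∈ Icc 0 R := fun hER t ht =>
    ⟨sq_nonneg _, (norm_half_sq_le_kirchhoffEnergy e lam _ _).trans (hER t ht)⟩
  -- The majorant `ψ` is `L²` times the squared gap of `|A^{1/2}·|²`; hence `D = L² · 4R`.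
  refine hmain lam ω T' _ _ (fun t => L ^ 2 * (‖powApply e lam (1 / 2) (y t)‖ ^ 2
      - ‖powApply e lam (1 / 2) (u t)‖ ^ 2) ^ 2) _ _ _ _ hT hω h.modes h'.modes
    (h'.isSpeed hl hmν hL0 hM hder hER') hBu ?_ ?_ ?_ G hG t ht s
  · have h1 : ContinuousOn (fun t => ‖powApply e lam (1 / 2) (u t)‖ ^ 2) (Icc 0 T') :=
      fun r hr => (h.hasDerivWithinAt_half_sq hl hr).continuousWithinAt
    have h2 : ContinuousOn (fun t => ‖powApply e lam (1 / 2) (y t)‖ ^ 2) (Icc 0 T') :=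
      fun r hr => (h'.hasDerivWithinAt_half_sq hl hr).continuousWithinAt
    exact ((h2.sub h1).pow 2).const_mul _
  · intro r hr
    rw [← mul_pow, ← sq_abs]
    refine (pow_le_pow_left₀ (abs_nonneg _) (hLip _ (hσ hER' r hr) _ (hσ hER r hr)) 2).trans_eq ?_
    rw [mul_pow, mul_pow, sq_abs]
  · intro r hr g hg
    rw [mul_assoc (L ^ 2)]
    exact mul_le_mul_of_nonneg_left (sq_sub_norm_half_sq_le hl (h.pos_continuous.1 r hr)
      (h.vel_continuous.1 r hr) (h'.pos_continuous.1 r hr) (h'.vel_continuous.1 r hr)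
      (hER r hr) (hER' r hr) hω hω1 hg) (sq_nonneg L)

/-- Each mode grows at most by a constant factor. -/
theorem exists_mode_growth [CompleteSpace H] (e : HilbertBasis ι ℝ H)
    (hl : ∀ k, 0 ≤ lam k) (hm : ContDiffOn ℝ 1 m (Ici 0)) {ν₀ : ℝ} (hν₀ : 0 < ν₀)
    (hmν : ∀ σ, 0 ≤ σ → ν₀ ≤ m σ) {R : ℝ} (hR : 0 ≤ R) (T : ℝ) :
    ∃ C : ℝ, 0 ≤ C ∧ ∀ (T' : ℝ) (u v : ℝ → H), T' ≤ T → IsModalSolution e lam m T' u v →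
      (∀ t ∈ Icc 0 T', kirchhoffEnergy e lam (u t) (v t) ≤ R) → ∀ t ∈ Icc 0 T', ∀ k,
        inner ℝ (v t) (e k) ^ 2 + lam k ^ 2 * inner ℝ (u t) (e k) ^ 2 ≤
          C * (inner ℝ (v 0) (e k) ^ 2 + lam k ^ 2 * inner ℝ (u 0) (e k) ^ 2) := by
  obtain ⟨M, L, hM0, hL0, hM, hder, -⟩ := exists_bounds_of_contDiffOn hm R
  exact ⟨_, by positivity, fun T' u v hT h hER t ht k => h.modes.energy_le hT hν₀ hM0
    (mul_nonneg hL0 hR) (h.isSpeed hl hmν hL0 hM hder hER) k ht⟩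

/-- Quantitative stability: low modes are compared in a weaker norm, high modes are controlled by
the tails of the initial data. -/
theorem exists_energy_sub_le [CompleteSpace H] (e : HilbertBasis ι ℝ H)
    (hl : ∀ k, 0 ≤ lam k) (hm : ContDiffOn ℝ 1 m (Ici 0)) {ν₀ : ℝ} (hν₀ : 0 < ν₀)
    (hmν : ∀ σ, 0 ≤ σ → ν₀ ≤ m σ) {R : ℝ} (hR : 0 ≤ R) (T : ℝ) :
    ∃ C : ℝ, 0 ≤ C ∧ ∀ (T' : ℝ) (u v y z : ℝ → H), T' ≤ T →
      IsModalSolution e lam m T' u v → IsModalSolution e lam m T' y z →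
      (∀ t ∈ Icc 0 T', kirchhoffEnergy e lam (u t) (v t) ≤ R) →
      (∀ t ∈ Icc 0 T', kirchhoffEnergy e lam (y t) (z t) ≤ R) →
      ∀ (r : Finset ι) (Λ : ℝ), 0 ≤ Λ → (∀ k ∈ r, lam k ≤ Λ) → ∀ t ∈ Icc 0 T',
        kirchhoffEnergy e lam (y t - u t) (z t - v t) ≤
          C * ((1 + Λ) ^ 2 * kirchhoffEnergy e lam (y 0 - u 0) (z 0 - v 0)
            + (kirchhoffEnergy e lam (u 0) (v 0) - ∑ k ∈ r, (1 + lam k) *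
              (inner ℝ (v 0) (e k) ^ 2 + lam k ^ 2 * inner ℝ (u 0) (e k) ^ 2))) := by
  classical
  obtain ⟨C₁, hC₁, hweak⟩ := exists_weighted_lipschitz e hl hm hν₀ hmν hR hR T
  obtain ⟨C₂, hC₂, hgrow⟩ := exists_mode_growth e hl hm hν₀ hmν hR T
  refine ⟨C₁ + 6 * C₂, by positivity, ?_⟩
  intro T' u v y z hT h h' hER hER' r Λ hΛ hr t ht
  have h0 : (0 : ℝ) ∈ Icc 0 T' := ⟨le_rfl, ht.1.trans ht.2⟩
  have hpos : ∀ k, 0 < 1 + lam k := fun k => by linarith [hl k]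
  have hw : ∀ t ∈ Icc 0 T', y t - u t ∈ powDomain e lam (3 / 4) := fun t ht =>
    (powDomain_sub hl (h'.pos_continuous.1 t ht) (h.pos_continuous.1 t ht)).1
  have hq : ∀ t ∈ Icc 0 T', z t - v t ∈ powDomain e lam (1 / 4) := fun t ht =>
    (powDomain_sub hl (h'.vel_continuous.1 t ht) (h.vel_continuous.1 t ht)).1
  set E₀ := kirchhoffEnergy e lam (y 0 - u 0) (z 0 - v 0) with hE₀
  have hE₀0 : 0 ≤ E₀ := kirchhoffEnergy_nonneg _ _ _ _
  -- With `ω = 1/(1+λ)` the source weight satisfies `ω λ⁴ ≤ (1+λ) λ²`, so the energy bound `R`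
  -- itself serves as `B`.
  have hlow := hweak (fun k => 1 / (1 + lam k)) T' u v y z hT
    (fun k => (one_div_pos.2 (hpos k)).le) (fun k => (one_div_mul_cancel (hpos k).ne').ge)
    h h' hER hER' (fun s t ht => by
      refine le_trans (Finset.sum_le_sum fun k _ => ?_) ((sum_pos_modes_le_energy hl
        (h.pos_continuous.1 t ht) (h.vel_continuous.1 t ht) s).trans (hER t ht))
      rw [div_mul_eq_mul_div, one_mul, div_le_iff₀ (hpos k)]
      have h1 : 0 ≤ inner ℝ (u t) (e k) ^ 2 := sq_nonneg _
      have h2 : lam k ^ 4 ≤ (1 + lam k) * lam k ^ 2 * (1 + lam k) := by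
        have := hl k
        nlinarith [pow_nonneg this 3, pow_nonneg this 2]
      nlinarith [mul_le_mul_of_nonneg_right h2 h1]) E₀ (fun s => by
      refine le_trans (Finset.sum_le_sum fun k _ => ?_) (sum_modes_le_energy hl
        (hw 0 h0) (hq 0 h0) s)
      refine mul_le_mul_of_nonneg_right ?_ (by positivity)
      rw [div_le_iff₀ (hpos k)]
      nlinarith [hl k]) t ht r
  have htail0 : ∀ s : Finset ι, Disjoint s r → ∑ k ∈ s, (1 + lam k) *
      (inner ℝ (v 0) (e k) ^ 2 + lam k ^ 2 * inner ℝ (u 0) (e k) ^ 2) ≤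
      kirchhoffEnergy e lam (u 0) (v 0) - ∑ k ∈ r, (1 + lam k) *
        (inner ℝ (v 0) (e k) ^ 2 + lam k ^ 2 * inner ℝ (u 0) (e k) ^ 2) := fun s hs => by
    rw [le_sub_iff_add_le, ← Finset.sum_union hs]
    exact sum_modes_le_energy hl (h.pos_continuous.1 0 h0) (h.vel_continuous.1 0 h0) _
  set τ := kirchhoffEnergy e lam (u 0) (v 0) - ∑ k ∈ r, (1 + lam k) *
        (inner ℝ (v 0) (e k) ^ 2 + lam k ^ 2 * inner ℝ (u 0) (e k) ^ 2) with hτ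
  have hτ0 : 0 ≤ τ := by simpa using htail0 ∅ (Finset.disjoint_empty_left r)
  -- On `r`, passing from the weight `1/(1+λ)` back to `1+λ` costs at most `(1+Λ)²`.
  have hhead : ∑ k ∈ r, (1 + lam k) * (inner ℝ (z t - v t) (e k) ^ 2
        + lam k ^ 2 * inner ℝ (y t - u t) (e k) ^ 2) ≤ (1 + Λ) ^ 2 * (C₁ * E₀) := by
    refine le_trans ?_ (mul_le_mul_of_nonneg_left hlow (sq_nonneg _))
    rw [Finset.mul_sum]
    refine Finset.sum_le_sum fun k hk => ?_
    rw [← mul_assoc]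
    refine mul_le_mul_of_nonneg_right ?_ (by positivity)
    rw [mul_one_div, le_div_iff₀ (hpos k), ← pow_two]
    exact pow_le_pow_left₀ (hpos k).le (by linarith [hr k hk]) 2
  -- Outside `r` nothing is gained from cancellation: both solutions are bounded separately by mode
  -- growth. The data of the second are twice the difference plus twice the data of the first,
  -- whence `6 = 2·2 + 2`.
  have htail : ∀ s : Finset ι, Disjoint s r → ∑ k ∈ s, (1 + lam k) *
      (inner ℝ (z t - v t) (e k) ^ 2 + lam k ^ 2 * inner ℝ (y t - u t) (e k) ^ 2) ≤
      6 * C₂ * (E₀ + τ) := fun s hs => by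
    have hterm : ∀ k ∈ s, (1 + lam k) *
        (inner ℝ (z t - v t) (e k) ^ 2 + lam k ^ 2 * inner ℝ (y t - u t) (e k) ^ 2) ≤
        6 * C₂ * ((1 + lam k) *
        (inner ℝ (z 0 - v 0) (e k) ^ 2 + lam k ^ 2 * inner ℝ (y 0 - u 0) (e k) ^ 2)
        + (1 + lam k) * (inner ℝ (v 0) (e k) ^ 2 + lam k ^ 2 * inner ℝ (u 0) (e k) ^ 2)) := by
      intro k _
      have h1 := hgrow T' u v hT h hER t ht k
      have h2 := hgrow T' y z hT h' hER' t ht k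
      simp only [inner_sub_left]
      rw [← mul_add, mul_left_comm]
      refine mul_le_mul_of_nonneg_left ?_ (hpos k).le
      generalize inner ℝ (v t) (e k) = vt at *
      generalize inner ℝ (u t) (e k) = ut at *
      generalize inner ℝ (z t) (e k) = zt at *
      generalize inner ℝ (y t) (e k) = yt at *
      generalize inner ℝ (v 0) (e k) = v0 at *
      generalize inner ℝ (u 0) (e k) = u0 at *
      generalize inner ℝ (z 0) (e k) = z0 at *
      generalize inner ℝ (y 0) (e k) = y0 at *
      have h3 : (zt - vt) ^ 2 + lam k ^ 2 * (yt - ut) ^ 2 ≤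
          2 * (zt ^ 2 + lam k ^ 2 * yt ^ 2) + 2 * (vt ^ 2 + lam k ^ 2 * ut ^ 2) := by
        nlinarith [sq_nonneg (zt + vt), mul_nonneg (sq_nonneg (lam k)) (sq_nonneg (yt + ut))]
      have h4 : z0 ^ 2 + lam k ^ 2 * y0 ^ 2 ≤ 2 * ((z0 - v0) ^ 2 + lam k ^ 2 * (y0 - u0) ^ 2)
          + 2 * (v0 ^ 2 + lam k ^ 2 * u0 ^ 2) := by
        nlinarith [sq_nonneg (z0 - 2 * v0),
          mul_nonneg (sq_nonneg (lam k)) (sq_nonneg (y0 - 2 * u0))]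
      have h5 := mul_le_mul_of_nonneg_left h4 hC₂
      have h6 : 0 ≤ C₂ * ((z0 - v0) ^ 2 + lam k ^ 2 * (y0 - u0) ^ 2) := by positivity
      have h7 : 0 ≤ C₂ * (v0 ^ 2 + lam k ^ 2 * u0 ^ 2) := by positivity
      linarith
    refine (Finset.sum_le_sum hterm).trans ?_
    rw [← Finset.mul_sum, Finset.sum_add_distrib]
    exact mul_le_mul_of_nonneg_left (add_le_add (sum_modes_le_energy hl (hw 0 h0) (hq 0 h0) s)
      (htail0 s hs)) (by positivity)
  refine hasSum_le_of_sum_le (hasSum_kirchhoffEnergy hl (hw t ht) (hq t ht)) fun s => ?_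
  have hsub : s ⊆ (s \ r) ∪ r := fun k hk => by by_cases hkr : k ∈ r <;> simp [hk, hkr]
  refine (Finset.sum_le_sum_of_subset_of_nonneg hsub fun k _ _ =>
    mul_nonneg (hpos k).le (by positivity)).trans ?_
  rw [Finset.sum_union Finset.sdiff_disjoint]
  have h1 := htail (s \ r) Finset.sdiff_disjoint
  have h2 : 1 ≤ (1 + Λ) ^ 2 := by nlinarith
  have h3 : C₂ * E₀ ≤ C₂ * E₀ * (1 + Λ) ^ 2 := le_mul_of_one_le_right (by positivity) h2
  have h4 : 0 ≤ C₁ * τ := by positivity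
  nlinarith

/-- A solution near a given one stays near it, for as long as both exist. -/
theorem IsModalSolution.exists_stability [CompleteSpace H]
    (hl : ∀ k, 0 ≤ lam k) (hm : ContDiffOn ℝ 1 m (Ici 0)) {ν₀ : ℝ} (hν₀ : 0 < ν₀)
    (hmν : ∀ σ, 0 ≤ σ → ν₀ ≤ m σ) (hT : 0 ≤ T) (h : IsModalSolution e lam m T u v) {δ : ℝ}
    (hδ : 0 < δ) :
    ∃ η : ℝ, 0 < η ∧ ∀ (T' : ℝ) (y z : ℝ → H), T' ≤ T → IsModalSolution e lam m T' y z →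
      kirchhoffEnergy e lam (y 0 - u 0) (z 0 - v 0) < η → ∀ t ∈ Icc 0 T',
        kirchhoffEnergy e lam (y t - u t) (z t - v t) ≤ δ := by
  obtain ⟨R, hR0, hR⟩ := h.exists_energy_le hl
  -- While the difference has energy at most `1`, the other solution has energy at most `2·1 + 2R`.
  obtain ⟨C, hC, hmain⟩ := exists_energy_sub_le e hl hm hν₀ hmν
    (by positivity : 0 ≤ 2 + 2 * R) T
  have h0 : (0 : ℝ) ∈ Icc 0 T := ⟨le_rfl, hT⟩
  set θ := min δ (1 / 2) with hθ
  have hθ0 : 0 < θ := by positivity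
  have hθ1 : θ ≤ 1 / 2 := min_le_right _ _
  set κ := θ / (2 * (C + 1)) with hκ
  have hκ0 : 0 < κ := by positivity
  have hCκ : C * (2 * κ) ≤ θ := by
    rw [hκ, ← mul_div_assoc, ← mul_div_assoc, div_le_iff₀ (by positivity)]
    nlinarith
  -- The low modes `r` leave a tail of the data of `u` below `κ`. The cutoff `Λ` depends only on `u`
  -- and the tolerance, not on the perturbation.
  obtain ⟨r, hr⟩ := ((hasSum_kirchhoffEnergy hl (h.pos_continuous.1 0 h0)
    (h.vel_continuous.1 0 h0)).eventually_const_lt (sub_lt_self _ hκ0)).exists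
  set Λ := ∑ k ∈ r, lam k with hΛ
  have hΛ0 : 0 ≤ Λ := Finset.sum_nonneg fun k _ => hl k
  have hrΛ : ∀ k ∈ r, lam k ≤ Λ := fun k hk =>
    Finset.single_le_sum (f := lam) (fun k _ => hl k) hk
  -- The first bound starts the continuity argument below `1`. The second makes the amplified
  -- initial difference less than `κ`, so that with the tail the total is at most `C · 2κ ≤ θ`.
  refine ⟨min (1 / 2) (κ / (1 + Λ) ^ 2), by positivity, fun T' y z hT' h' hη t ht => ?_⟩
  have hη1 := hη.trans_le (min_le_left _ _)
  have hη2 := hη.trans_le (min_le_right _ _)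
  rw [lt_div_iff₀ (by positivity)] at hη2
  refine (le_of_bootstrap ((h.mono hT').continuousOn_energy_sub hl h')
    (hθ1.trans_lt (by norm_num)) (hη1.trans (by norm_num)) (fun t ht hle => ?_) t ht).trans
    (min_le_left _ _)
  have hsub : Icc 0 t ⊆ Icc 0 T' := Icc_subset_Icc_right ht.2
  have htT := ht.2.trans hT'
  have hsubT : Icc 0 t ⊆ Icc 0 T := Icc_subset_Icc_right htT
  have := hmain t u v y z htT (h.mono htT) (h'.mono ht.2)
    (fun x hx => (hR x (hsubT hx)).trans (by linarith)) (fun x hx => by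
      have h1 := kirchhoffEnergy_le_sub hl (h'.pos_continuous.1 x (hsub hx))
        (h'.vel_continuous.1 x (hsub hx)) (h.pos_continuous.1 x (hsubT hx))
        (h.vel_continuous.1 x (hsubT hx))
      linarith [hle x hx, hR x (hsubT hx)]) r Λ hΛ0 hrΛ t ⟨ht.1, le_rfl⟩
  refine this.trans (le_trans (mul_le_mul_of_nonneg_left ?_ hC) hCκ)
  linarith

/-- Lipschitz dependence in the energy norm at a solution with more regular initial data. -/
theorem IsModalSolution.exists_energy_lipschitz [CompleteSpace H]
    (hl : ∀ k, 0 ≤ lam k) (hm : ContDiffOn ℝ 1 m (Ici 0)) {ν₀ : ℝ} (hν₀ : 0 < ν₀)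
    (hmν : ∀ σ, 0 ≤ σ → ν₀ ≤ m σ) (h : IsModalSolution e lam m T u v)
    (hu : u 0 ∈ powDomain e lam (5 / 4)) (hv : v 0 ∈ powDomain e lam (3 / 4)) {R : ℝ}
    (hR0 : 0 ≤ R) (hR : ∀ t ∈ Icc 0 T, kirchhoffEnergy e lam (u t) (v t) ≤ R) :
    ∃ Γ : ℝ, ∀ y z : ℝ → H, IsModalSolution e lam m T y z →
      (∀ t ∈ Icc 0 T, kirchhoffEnergy e lam (y t) (z t) ≤ R) → ∀ t ∈ Icc 0 T,
        kirchhoffEnergy e lam (y t - u t) (z t - v t) ≤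
          Γ * kirchhoffEnergy e lam (y 0 - u 0) (z 0 - v 0) := by
  have hu' : Summable fun k => lam k ^ (4 * (5 / 4 : ℝ)) * inner ℝ (u 0) (e k) ^ 2 := hu
  have hv' : Summable fun k => lam k ^ (4 * (3 / 4 : ℝ)) * inner ℝ (v 0) (e k) ^ 2 := hv
  simp only [rpow_four_mul_three_quarters, rpow_four_mul_five_quarters] at hu' hv'
  -- The extra regularity of the data is finiteness of the energy with additional weight `λ²`. Mode
  -- growth propagates it in time, so `∑ (1+λ) λ⁴ u_k²` stays bounded.
  have hsum : Summable fun k => (1 + lam k) * lam k ^ 2 *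
      (inner ℝ (v 0) (e k) ^ 2 + lam k ^ 2 * inner ℝ (u 0) (e k) ^ 2) := by
    refine Summable.of_nonneg_of_le (fun k => by have := hl k; positivity) (fun k => ?_)
      (((hasSum_coord_sq e (v 0)).summable.add (hv'.mul_left 2)).add
        ((hasSum_coord_sq e (u 0)).summable.add (hu'.mul_left 2)))
    have hk := hl k
    have h2 : lam k ^ 2 ≤ 1 + lam k ^ 3 := by
      nlinarith [sq_nonneg (lam k - 1), mul_nonneg hk (sq_nonneg (lam k - 1))]
    have h4 : lam k ^ 4 ≤ 1 + lam k ^ 5 := by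
      rcases le_total (lam k) 1 with h1 | h1
      · linarith [pow_le_one₀ (n := 4) hk h1, pow_nonneg hk 5]
      · nlinarith [pow_nonneg hk 4]
    nlinarith [mul_le_mul_of_nonneg_right h2 (sq_nonneg (inner ℝ (v 0) (e k))),
      mul_le_mul_of_nonneg_right h4 (sq_nonneg (inner ℝ (u 0) (e k)))]
  obtain ⟨C₂, hC₂, hgrow⟩ := exists_mode_growth e hl hm hν₀ hmν hR0 T
  set S := ∑' k, (1 + lam k) * lam k ^ 2 *
      (inner ℝ (v 0) (e k) ^ 2 + lam k ^ 2 * inner ℝ (u 0) (e k) ^ 2) with hS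
  have hS0 : 0 ≤ S := tsum_nonneg fun k => by have := hl k; positivity
  obtain ⟨C, hC, hmain⟩ := exists_weighted_lipschitz e hl hm hν₀ hmν hR0
    (mul_nonneg hC₂ hS0) T
  refine ⟨C, fun y z h' hR' t ht => ?_⟩
  have h0 : (0 : ℝ) ∈ Icc 0 T := ⟨le_rfl, ht.1.trans ht.2⟩
  have hw : ∀ t ∈ Icc 0 T, y t - u t ∈ powDomain e lam (3 / 4) := fun t ht =>
    (powDomain_sub hl (h'.pos_continuous.1 t ht) (h.pos_continuous.1 t ht)).1
  have hq : ∀ t ∈ Icc 0 T, z t - v t ∈ powDomain e lam (1 / 4) := fun t ht =>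
    (powDomain_sub hl (h'.vel_continuous.1 t ht) (h.vel_continuous.1 t ht)).1
  refine hasSum_le_of_sum_le (hasSum_kirchhoffEnergy hl (hw t ht) (hq t ht)) fun s => ?_
  -- With weight `1 + λ` the weighted norm is the energy itself, so no splitting into low and high
  -- modes is needed.
  refine hmain (fun k => 1 + lam k) T u v y z le_rfl (fun k => by linarith [hl k])
    (fun k => by nlinarith [hl k]) h h' hR hR' (fun s t ht => ?_) _
    (fun s => sum_modes_le_energy hl (hw 0 h0) (hq 0 h0) s) t ht s
  refine le_trans ?_ (mul_le_mul_of_nonneg_left (hsum.sum_le_tsum s fun k _ => by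
    have := hl k; positivity) hC₂)
  rw [Finset.mul_sum]
  refine Finset.sum_le_sum fun k _ => ?_
  have hk := hl k
  have h1 := mul_le_mul_of_nonneg_left (hgrow T u v le_rfl h hR t ht k)
    (by positivity : 0 ≤ (1 + lam k) * lam k ^ 2)
  have h2 : 0 ≤ (1 + lam k) * lam k ^ 2 * inner ℝ (v t) (e k) ^ 2 := by positivity
  linarith

end

/-! ### Global solutions with finitely many modes. -/

section FiniteModes

/-- Global solvability of the Kirchhoff system with finitely many modes. -/
theorem exists_finite_mode_solution {κ : Type*} [Fintype κ] (μ : κ → ℝ) {m : ℝ → ℝ}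
    (hm : ContDiffOn ℝ 1 m (Ici 0)) (hm0 : ∀ σ, 0 ≤ σ → 0 ≤ m σ) (a b : κ → ℝ) {T : ℝ}
    (hT : 0 ≤ T) :
    ∃ y z : ℝ → κ → ℝ, y 0 = a ∧ z 0 = b ∧ ∀ t ∈ Icc 0 T, ∀ k,
      HasDerivWithinAt (fun r => y r k) (z t k) (Icc 0 T) t ∧
      HasDerivWithinAt (fun r => z r k) (-(m (∑ j, μ j ^ 2 * y t j ^ 2) * (μ k ^ 2 * y t k)))
        (Icc 0 T) t := by
  classical
  set S : (κ → ℝ) × (κ → ℝ) → ℝ := fun x => ∑ j, μ j ^ 2 * x.1 j ^ 2 with hS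
  have hS0 : ∀ x, 0 ≤ S x := fun x => Finset.sum_nonneg fun j _ => by positivity
  have hSc : ContDiff ℝ 1 S := by
    refine ContDiff.sum fun j _ => ?_
    fun_prop
  set F : (κ → ℝ) × (κ → ℝ) → (κ → ℝ) × (κ → ℝ) :=
    fun x => (x.2, fun k => -(m (S x) * (μ k ^ 2 * x.1 k))) with hF
  have hFc : ContDiff ℝ 1 F := by
    have hmS : ContDiff ℝ 1 fun x => m (S x) := hm.comp_contDiff hSc hS0
    refine contDiff_snd.prodMk (contDiff_pi.2 fun k => ?_)
    exact (hmS.mul (by fun_prop)).neg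
  -- Potential energy: a primitive of `m`, extended as a constant to the left of `0` so that the
  -- integrand is continuous on the line. The Hamiltonian is `∑ z_k² + P(∑ μ_k² y_k²)`.
  set P : ℝ → ℝ := fun σ => ∫ s in (0 : ℝ)..σ, m (max 0 s) with hP
  have hmc : Continuous fun s => m (max 0 s) := by
    rw [← continuousOn_univ]
    exact hm.continuousOn.comp (continuous_const.max continuous_id).continuousOn
      fun s _ => mem_Ici.2 (le_max_left _ _)
  have hPd : ∀ σ, 0 ≤ σ → HasDerivAt P (m σ) σ := fun σ hσ => by
    simpa [max_eq_right hσ] using (hmc.integral_hasStrictDerivAt 0 σ).hasDerivAt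
  have hP0 : ∀ σ, 0 ≤ σ → 0 ≤ P σ := fun σ hσ =>
    intervalIntegral.integral_nonneg hσ fun s _ => hm0 _ (le_max_left _ _)
  set N : ℝ := ∑ k, b k ^ 2 + P (S (a, b)) with hN
  set Z : ℝ := Real.sqrt N with hZ
  have hZ0 : 0 ≤ Z := Real.sqrt_nonneg _
  set ρ : ℝ := ‖a‖ + Z * T + Z + 1 with hρ
  have hρ0 : 0 < ρ := by positivity
  -- The cutoff makes the field bounded and globally Lipschitz, so Picard–Lindelöf covers all of
  -- `[0,T]` at once. The radius `ρ` exceeds the a priori bounds proved below.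
  let χ : ContDiffBump (0 : (κ → ℝ) × (κ → ℝ)) := ⟨ρ, ρ + 1, hρ0, lt_add_one ρ⟩
  have hfc : ContDiff ℝ 1 fun x => χ x • F x := χ.contDiff.smul hFc
  have hfs : HasCompactSupport fun x => χ x • F x := χ.hasCompactSupport.smul_right
  obtain ⟨K, hK⟩ := hfc.lipschitzWith_of_hasCompactSupport hfs one_ne_zero
  obtain ⟨L, hL⟩ := hfs.exists_bound_of_continuous hfc.continuous
  have hPL : IsPicardLindelof (fun _ x => χ x • F x) (⟨0, le_rfl, hT⟩ : Icc 0 T) (a, b)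
      (L.toNNReal * T.toNNReal) 0 L.toNNReal K := by
    refine ⟨fun t _ => hK.lipschitzOnWith, fun x _ => continuousOn_const,
      fun t _ x _ => (hL x).trans (Real.le_coe_toNNReal _), ?_⟩
    simp [max_eq_left hT]
  obtain ⟨α, hα0, hα⟩ := hPL.exists_eq_forall_mem_Icc_hasDerivWithinAt₀
  simp only at hα0
  have h1 : ∀ t ∈ Icc 0 T, ∀ k, HasDerivWithinAt (fun r => (α r).1 k)
      (χ (α t) * (α t).2 k) (Icc 0 T) t := fun t ht k => by
    exact ((ContinuousLinearMap.proj (R := ℝ) (φ := fun _ : κ => ℝ) k).comp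
      (ContinuousLinearMap.fst ℝ (κ → ℝ) (κ → ℝ))).hasFDerivAt.comp_hasDerivWithinAt t (hα t ht)
  have h2 : ∀ t ∈ Icc 0 T, ∀ k, HasDerivWithinAt (fun r => (α r).2 k)
      (χ (α t) * -(m (S (α t)) * (μ k ^ 2 * (α t).1 k))) (Icc 0 T) t := fun t ht k => by
    exact ((ContinuousLinearMap.proj (R := ℝ) (φ := fun _ : κ => ℝ) k).comp
      (ContinuousLinearMap.snd ℝ (κ → ℝ) (κ → ℝ))).hasFDerivAt.comp_hasDerivWithinAt t (hα t ht)
  -- The cut-off field is a scalar multiple of `F`, so it conserves the same Hamiltonian. The bounds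
  -- thus hold before it is known that the cutoff equals `1`, and they then prove it.
  have hcons : ∀ t ∈ Icc 0 T, ∑ k, (α t).2 k ^ 2 + P (S (α t)) = N := fun t ht => by
    have hd : ∀ t ∈ Icc 0 T, HasDerivWithinAt (fun r => ∑ k, (α r).2 k ^ 2 + P (S (α r))) 0
        (Icc 0 T) t := fun t ht => by
      have hd1 := HasDerivWithinAt.fun_sum (u := Finset.univ) fun k _ => (h2 t ht k).pow 2
      have hd2 := HasDerivWithinAt.fun_sum (u := Finset.univ)
        fun k _ => ((h1 t ht k).pow 2).const_mul (μ k ^ 2)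
      refine (hd1.add ((hPd (S (α t)) (hS0 _)).comp_hasDerivWithinAt t hd2)).congr_deriv ?_
      rw [Finset.mul_sum, ← Finset.sum_add_distrib]
      refine Finset.sum_eq_zero fun k _ => ?_
      push_cast
      ring
    have := eq_add_integral_of_hasDerivWithinAt hd continuousOn_const ht
    rw [this, hα0]
    simp [hN]
  have hz : ∀ t ∈ Icc 0 T, ∀ k, |(α t).2 k| ≤ Z := fun t ht k => by
    refine Real.abs_le_sqrt ?_
    rw [← hcons t ht]
    have := Finset.single_le_sum (f := fun k => (α t).2 k ^ 2) (fun k _ => sq_nonneg _)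
      (Finset.mem_univ k)
    linarith [hP0 _ (hS0 (α t))]
  -- The Hamiltonian does not see positions with `μ k = 0`; positions are bounded by integrating the
  -- velocity.
  have hy : ∀ t ∈ Icc 0 T, ∀ k, |(α t).1 k| ≤ ‖a‖ + Z * T := fun t ht k => by
    have hb := (convex_Icc 0 T).norm_image_sub_le_of_norm_hasDerivWithin_le
      (fun r hr => h1 r hr k) (C := Z) (fun r hr => by
        rw [Real.norm_eq_abs, abs_mul, abs_of_nonneg χ.nonneg]
        exact (mul_le_of_le_one_left (abs_nonneg _) χ.le_one).trans (hz r hr k))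
      ⟨le_rfl, hT⟩ ht
    rw [hα0, Real.norm_eq_abs, Real.norm_eq_abs, sub_zero, abs_of_nonneg ht.1] at hb
    have h3 := norm_le_pi_norm a k
    rw [Real.norm_eq_abs] at h3
    have h4 := abs_add_le ((α t).1 k - a k) (a k)
    rw [sub_add_cancel] at h4
    have h5 := mul_le_mul_of_nonneg_left ht.2 hZ0
    simp only at hb
    linarith
  have hχ : ∀ t ∈ Icc 0 T, χ (α t) = 1 := fun t ht => by
    refine χ.one_of_mem_closedBall ?_
    rw [mem_closedBall_zero_iff]
    have hZT : 0 ≤ Z * T := mul_nonneg hZ0 hT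
    have ha := norm_nonneg a
    refine norm_prod_le_iff.2 ⟨(pi_norm_le_iff_of_nonneg hρ0.le).2 fun k => ?_,
      (pi_norm_le_iff_of_nonneg hρ0.le).2 fun k => ?_⟩
    · exact (hy t ht k).trans (by rw [hρ]; linarith)
    · exact (hz t ht k).trans (by rw [hρ]; linarith)
  refine ⟨fun t => (α t).1, fun t => (α t).2, by simp [hα0], by simp [hα0], fun t ht k => ⟨?_, ?_⟩⟩
  · simpa [hχ t ht] using h1 t ht k
  · simpa [hχ t ht] using h2 t ht k

end FiniteModes

/-! ### Truncated data and their solutions. -/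

section Truncation

variable {ι H : Type*} [NormedAddCommGroup H] [InnerProductSpace ℝ H] {e : HilbertBasis ι ℝ H}
  {lam : ι → ℝ}

theorem inner_finset_sum_smul [DecidableEq ι] (e : HilbertBasis ι ℝ H) (s : Finset ι)
    (c : ι → ℝ) (j : ι) :
    inner ℝ (∑ k ∈ s, c k • e k) (e j) = if j ∈ s then c j else 0 := by
  simp [sum_inner, inner_smul_left, orthonormal_iff_ite.1 e.orthonormal]

theorem powApply_finset_sum_smul (hl : ∀ k, 0 ≤ lam k) (σ : ℝ) (s : Finset ι) (c : ι → ℝ) :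
    ∑ k ∈ s, c k • e k ∈ powDomain e lam σ ∧ powApply e lam σ (∑ k ∈ s, c k • e k) =
      ∑ k ∈ s, (lam k ^ (2 * σ) * c k) • e k := by
  classical
  refine mem_powDomain_and_powApply_eq hl fun j => ?_
  rw [inner_finset_sum_smul, inner_finset_sum_smul]
  split_ifs <;> simp

theorem isC0InPow_finset_sum_smul (hl : ∀ k, 0 ≤ lam k) (σ : ℝ) (s : Finset ι) {T : ℝ}
    {c : ℝ → ι → ℝ} (hc : ∀ k ∈ s, ContinuousOn (fun t => c t k) (Icc 0 T)) :
    IsC0InPow e lam σ T (fun t => ∑ k ∈ s, c t k • e k) := by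
  refine ⟨fun t _ => (powApply_finset_sum_smul hl σ s (c t)).1, fun t ht => ⟨?_, ?_⟩⟩
  · exact tendsto_finsetSum _ fun k hk => (hc k hk t ht).smul_const _
  · simp only [(powApply_finset_sum_smul hl σ s _).2]
    exact tendsto_finsetSum _ fun k hk => ((hc k hk t ht).const_mul _).smul_const _

/-- The span of finitely many `e_k` is invariant, since the modes interact only through a scalar. A
finite system, padded by zeros outside `s`, is therefore a solution in `H`. -/
theorem exists_truncated_solution {m : ℝ → ℝ} (hl : ∀ k, 0 ≤ lam k)
    (hm : ContDiffOn ℝ 1 m (Ici 0)) (hm0 : ∀ σ, 0 ≤ σ → 0 ≤ m σ) (a b : H) {T : ℝ}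
    (hT : 0 ≤ T) (s : Finset ι) :
    ∃ u v : ℝ → H, IsModalSolution e lam m T u v ∧
      u 0 = ∑ k ∈ s, inner ℝ a (e k) • e k ∧ v 0 = ∑ k ∈ s, inner ℝ b (e k) • e k := by
  classical
  obtain ⟨y, z, hy0, hz0, hyz⟩ := exists_finite_mode_solution (fun k : s => lam k) hm hm0
    (fun k : s => inner ℝ a (e k)) (fun k : s => inner ℝ b (e k)) hT
  set Y : ℝ → ι → ℝ := fun t k => if h : k ∈ s then y t ⟨k, h⟩ else 0 with hY
  set Z : ℝ → ι → ℝ := fun t k => if h : k ∈ s then z t ⟨k, h⟩ else 0 with hZ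
  have hσ : ∀ t, ‖powApply e lam (1 / 2) (∑ k ∈ s, Y t k • e k)‖ ^ 2
      = ∑ j : s, lam j ^ 2 * y t j ^ 2 := fun t => by
    have h1 := hasSum_norm_half_sq hl (powApply_finset_sum_smul (e := e) hl (3 / 4) s (Y t)).1
    simp only [inner_finset_sum_smul] at h1
    rw [h1.unique (hasSum_sum_of_ne_finset_zero (s := s) fun k hk => by simp [hk]),
      ← Finset.sum_coe_sort s]
    refine Finset.sum_congr rfl fun k _ => ?_
    simp [hY]
  have hpos : ∀ k, ∀ t ∈ Icc 0 T, HasDerivWithinAt (fun r => Y r k) (Z t k) (Icc 0 T) t := by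
    intro k t ht
    by_cases hk : k ∈ s
    · simpa [hY, hZ, hk] using (hyz t ht ⟨k, hk⟩).1
    · simpa [hY, hZ, hk] using hasDerivWithinAt_const t (Icc 0 T) (0 : ℝ)
  have hvel : ∀ k, ∀ t ∈ Icc 0 T, HasDerivWithinAt (fun r => Z r k)
      (-(m (∑ j : s, lam j ^ 2 * y t j ^ 2) * (lam k ^ 2 * Y t k))) (Icc 0 T) t := by
    intro k t ht
    by_cases hk : k ∈ s
    · simpa only [hY, hZ, hk, dite_true] using (hyz t ht ⟨k, hk⟩).2
    · simpa [hY, hZ, hk] using hasDerivWithinAt_const t (Icc 0 T) (0 : ℝ)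
  refine ⟨fun t => ∑ k ∈ s, Y t k • e k, fun t => ∑ k ∈ s, Z t k • e k,
    ⟨isC0InPow_finset_sum_smul hl _ s fun k _ t ht => (hpos k t ht).continuousWithinAt,
     isC0InPow_finset_sum_smul hl _ s fun k _ t ht => (hvel k t ht).continuousWithinAt,
     fun k t ht => ?_, fun k t ht => ?_⟩, ?_, ?_⟩
  · simp only [inner_finset_sum_smul]
    by_cases hk : k ∈ s
    · simpa only [hk, if_true] using hpos k t ht
    · simpa only [hk, if_false] using hasDerivWithinAt_const t (Icc 0 T) (0 : ℝ)
  · simp only [inner_finset_sum_smul, hσ]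
    by_cases hk : k ∈ s
    · simpa only [hk, if_true] using hvel k t ht
    · simpa [hk] using hasDerivWithinAt_const t (Icc 0 T) (0 : ℝ)
  · exact Finset.sum_congr rfl fun k hk => by simp [hY, hk, hy0]
  · exact Finset.sum_congr rfl fun k hk => by simp [hZ, hk, hz0]

/-- The energy of the part of the data that a truncation removes. -/
theorem kirchhoffEnergy_truncation_sub (hl : ∀ k, 0 ≤ lam k) {a b : H}
    (ha : a ∈ powDomain e lam (3 / 4)) (hb : b ∈ powDomain e lam (1 / 4)) (s : Finset ι) :
    kirchhoffEnergy e lam (∑ k ∈ s, inner ℝ a (e k) • e k - a)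
      (∑ k ∈ s, inner ℝ b (e k) • e k - b) = kirchhoffEnergy e lam a b -
        ∑ k ∈ s, (1 + lam k) * (inner ℝ b (e k) ^ 2 + lam k ^ 2 * inner ℝ a (e k) ^ 2) := by
  classical
  refine (hasSum_kirchhoffEnergy hl
    (powDomain_sub hl (powApply_finset_sum_smul hl _ s _).1 ha).1
    (powDomain_sub hl (powApply_finset_sum_smul hl _ s _).1 hb).1).unique ?_
  have h1 : HasSum (fun k => if k ∈ s then
      (1 + lam k) * (inner ℝ b (e k) ^ 2 + lam k ^ 2 * inner ℝ a (e k) ^ 2) else 0)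
      (∑ k ∈ s, (1 + lam k) * (inner ℝ b (e k) ^ 2 + lam k ^ 2 * inner ℝ a (e k) ^ 2)) := by
    rw [← Finset.sum_congr rfl fun k hk => if_pos hk]
    exact hasSum_sum_of_ne_finset_zero fun k hk => if_neg hk
  refine ((hasSum_kirchhoffEnergy hl ha hb).sub h1).congr_fun fun k => ?_
  simp only [inner_sub_left, inner_finset_sum_smul]
  split_ifs <;> ring

theorem kirchhoffEnergy_truncation (hl : ∀ k, 0 ≤ lam k) (a b : H) (s : Finset ι) :
    kirchhoffEnergy e lam (∑ k ∈ s, inner ℝ a (e k) • e k) (∑ k ∈ s, inner ℝ b (e k) • e k) =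
      ∑ k ∈ s, (1 + lam k) * (inner ℝ b (e k) ^ 2 + lam k ^ 2 * inner ℝ a (e k) ^ 2) := by
  classical
  have h := (hasSum_kirchhoffEnergy (e := e) hl
    (powApply_finset_sum_smul hl _ s (fun k => inner ℝ a (e k))).1
    (powApply_finset_sum_smul hl _ s (fun k => inner ℝ b (e k))).1)
  simp only [inner_finset_sum_smul] at h
  rw [h.unique (hasSum_sum_of_ne_finset_zero (s := s) fun k hk => by simp [hk])]
  exact Finset.sum_congr rfl fun k hk => by simp [hk]

theorem tendsto_truncation (e : HilbertBasis ι ℝ H) (a : H) :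
    Tendsto (fun s : Finset ι => ∑ k ∈ s, inner ℝ a (e k) • e k) atTop (𝓝 a) := by
  have h := e.hasSum_repr a
  simp only [e.repr_apply_apply, real_inner_comm] at h
  simpa [HasSum] using h

end Truncation

/-! ### Passage to the limit. -/

theorem exists_tendstoUniformlyOn_of_cauchy {α X E : Type*} [SemilatticeSup α] [Nonempty α]
    [NormedAddCommGroup E] [CompleteSpace E] {F : α → X → E} {S : Set X}
    (h : ∀ δ : ℝ, 0 < δ → ∃ N, ∀ p, N ≤ p → ∀ q, N ≤ q → ∀ x ∈ S, ‖F p x - F q x‖ ≤ δ) :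
    ∃ f : X → E, TendstoUniformlyOn F f atTop S := by
  classical
  have hc : UniformCauchySeqOn F atTop S := Metric.uniformCauchySeqOn_iff.2 fun δ hδ => by
    obtain ⟨N, hN⟩ := h (δ / 2) (half_pos hδ)
    exact ⟨N, fun p hp q hq x hx => by
      rw [dist_eq_norm]; exact (hN p hp q hq x hx).trans_lt (half_lt_self hδ)⟩
  have hlim : ∀ x, ∃ y, x ∈ S → Tendsto (fun p => F p x) atTop (𝓝 y) := fun x => by
    by_cases hx : x ∈ S
    · obtain ⟨y, hy⟩ := cauchy_map_iff_exists_tendsto.1 (hc.cauchy_map hx)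
      exact ⟨y, fun _ => hy⟩
    · exact ⟨0, fun h => absurd h hx⟩
  choose f hf using hlim
  exact ⟨f, hc.tendstoUniformlyOn_of_tendsto hf⟩

/-- The limit is taken in the integrated equation by dominated convergence. This needs a countably
generated filter, and is the reason for a countable basis: the finite sets of indices are then
countable. -/
theorem hasDerivWithinAt_of_tendsto_of_bounded {α : Type*} {l : Filter α} [l.NeBot]
    [l.IsCountablyGenerated] {T B : ℝ} {F G : α → ℝ → ℝ} {f g : ℝ → ℝ}
    (hFG : ∀ᶠ a in l, ∀ t ∈ Icc 0 T, HasDerivWithinAt (F a) (G a t) (Icc 0 T) t)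
    (hG : ∀ᶠ a in l, ContinuousOn (G a) (Icc 0 T))
    (hB : ∀ᶠ a in l, ∀ t ∈ Icc 0 T, |G a t| ≤ B)
    (hf : ∀ t ∈ Icc 0 T, Tendsto (fun a => F a t) l (𝓝 (f t)))
    (hg : ∀ t ∈ Icc 0 T, Tendsto (fun a => G a t) l (𝓝 (g t)))
    (hgc : ContinuousOn g (Icc 0 T)) {t : ℝ} (ht : t ∈ Icc 0 T) :
    HasDerivWithinAt f (g t) (Icc 0 T) t := by
  have key : ∀ r ∈ Icc 0 T, f r = f 0 + ∫ x in (0 : ℝ)..r, g x := fun r hr => by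
    have hsub : Set.uIoc 0 r ⊆ Icc 0 T := by
      rw [uIoc_of_le hr.1]
      exact fun x hx => ⟨hx.1.le, hx.2.trans hr.2⟩
    have hI : Tendsto (fun a => ∫ x in (0 : ℝ)..r, G a x) l (𝓝 (∫ x in (0 : ℝ)..r, g x)) := by
      refine intervalIntegral.tendsto_integral_filter_of_dominated_convergence (fun _ => B)
        ?_ ?_ intervalIntegrable_const (Eventually.of_forall fun x hx => hg x (hsub hx))
      · filter_upwards [hG] with a ha
        exact (ha.mono hsub).aestronglyMeasurable measurableSet_uIoc
      · filter_upwards [hB] with a ha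
        exact Eventually.of_forall fun x hx => ha x (hsub hx)
    refine tendsto_nhds_unique (hf r hr) (((hf 0 ⟨le_rfl, hr.1.trans hr.2⟩).add hI).congr' ?_)
    filter_upwards [hFG, hG] with a ha ha'
    exact (eq_add_integral_of_hasDerivWithinAt ha ha' hr).symm
  exact ((hasDerivWithinAt_integral_Icc hgc ht).const_add (f 0)).congr key (key t ht)

section

variable {ι H : Type*} [NormedAddCommGroup H] [InnerProductSpace ℝ H] {e : HilbertBasis ι ℝ H}
  {lam : ι → ℝ} {m : ℝ → ℝ} {T : ℝ} {u v : ℝ → H}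

theorem norm_half_sq_le (hl : ∀ k, 0 ≤ lam k) {x : H} (hx : x ∈ powDomain e lam (3 / 4)) :
    ‖powApply e lam (1 / 2) x‖ ^ 2 ≤ ‖x‖ ^ 2 + ‖powApply e lam (3 / 4) x‖ ^ 2 := by
  have h := hasSum_norm_powApply_sq hl hx
  simp only [rpow_four_mul_three_quarters] at h
  refine hasSum_le (fun k => ?_) (hasSum_norm_half_sq hl hx) ((hasSum_coord_sq e x).add h)
  have := hl k
  nlinarith [mul_nonneg (sq_nonneg (inner ℝ x (e k)))
    (by nlinarith [sq_nonneg (lam k - 1), mul_nonneg this (sq_nonneg (lam k - 1))] :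
      0 ≤ 1 + lam k ^ 3 - lam k ^ 2)]

/-- Interpolation through `λ² ≤ 1 + λ³`: the graph norm of `A^{3/4}` controls `A^{1/2}`. -/
theorem TendstoInPow.half {α : Type*} {l : Filter α} {f : α → H} {z : H}
    (hl : ∀ k, 0 ≤ lam k) (h : TendstoInPow e lam (3 / 4) f l z)
    (hf : ∀ᶠ a in l, f a ∈ powDomain e lam (3 / 4)) (hz : z ∈ powDomain e lam (3 / 4)) :
    Tendsto (fun a => powApply e lam (1 / 2) (f a)) l (𝓝 (powApply e lam (1 / 2) z)) := by
  rw [tendsto_iff_norm_sub_tendsto_zero]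
  have h1 := tendsto_iff_norm_sub_tendsto_zero.1 h.1
  have h2 := tendsto_iff_norm_sub_tendsto_zero.1 h.2
  have h3 := ((h1.pow 2).add (h2.pow 2)).sqrt
  simp only [ne_eq, OfNat.ofNat_ne_zero, not_false_eq_true, zero_pow, add_zero,
    Real.sqrt_zero] at h3
  refine squeeze_zero' (Eventually.of_forall fun _ => norm_nonneg _) ?_ h3
  filter_upwards [hf] with a ha
  refine Real.le_sqrt_of_sq_le ?_
  have := norm_half_sq_le hl (powDomain_sub hl ha hz).1
  rwa [(powDomain_sub hl ha hz).2, (powDomain_sub hl (half_of_three_quarters hl ha)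
    (half_of_three_quarters hl hz)).2] at this

theorem tendsto_kirchhoffEnergy_sub {α : Type*} {l : Filter α} {f g : α → H} {x y : H}
    (hl : ∀ k, 0 ≤ lam k) (hf : TendstoInPow e lam (3 / 4) f l x)
    (hg : TendstoInPow e lam (1 / 4) g l y)
    (hfm : ∀ᶠ a in l, f a ∈ powDomain e lam (3 / 4)) (hx : x ∈ powDomain e lam (3 / 4))
    (hgm : ∀ᶠ a in l, g a ∈ powDomain e lam (1 / 4)) (hy : y ∈ powDomain e lam (1 / 4)) :
    Tendsto (fun a => kirchhoffEnergy e lam (f a - x) (g a - y)) l (𝓝 0) := by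
  have h1 := (tendsto_iff_norm_sub_tendsto_zero.1 hg.1).pow 2
  have h2 := (tendsto_iff_norm_sub_tendsto_zero.1 hg.2).pow 2
  have h3 := (tendsto_iff_norm_sub_tendsto_zero.1 (hf.half hl hfm hx)).pow 2
  have h4 := (tendsto_iff_norm_sub_tendsto_zero.1 hf.2).pow 2
  have h := ((h1.add h2).add h3).add h4
  simp only [ne_eq, OfNat.ofNat_ne_zero, not_false_eq_true, zero_pow, add_zero] at h
  refine h.congr' ?_
  filter_upwards [hfm, hgm] with a ha hb
  rw [kirchhoffEnergy, (powDomain_sub hl ha hx).2, (powDomain_sub hl hb hy).2,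
    (powDomain_sub hl (half_of_three_quarters hl ha) (half_of_three_quarters hl hx)).2]

theorem IsC0InPow.continuousOn_half {f : ℝ → H} (hl : ∀ k, 0 ≤ lam k)
    (h : IsC0InPow e lam (3 / 4) T f) :
    ContinuousOn (fun t => powApply e lam (1 / 2) (f t)) (Icc 0 T) := fun t ht =>
  (h.2 t ht).half hl (eventually_nhdsWithin_of_forall h.1) (h.1 t ht)

theorem norm_vel_sq_le_kirchhoffEnergy (e : HilbertBasis ι ℝ H) (lam : ι → ℝ) (x y : H) :
    ‖y‖ ^ 2 ≤ kirchhoffEnergy e lam x y := by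
  have h1 := sq_nonneg ‖powApply e lam (1 / 2) x‖
  have h2 := sq_nonneg ‖powApply e lam (1 / 4) y‖
  have h3 := sq_nonneg ‖powApply e lam (3 / 4) x‖
  unfold kirchhoffEnergy; linarith

theorem norm_quarter_vel_sq_le_kirchhoffEnergy (e : HilbertBasis ι ℝ H) (lam : ι → ℝ) (x y : H) :
    ‖powApply e lam (1 / 4) y‖ ^ 2 ≤ kirchhoffEnergy e lam x y := by
  have h1 := sq_nonneg ‖powApply e lam (1 / 2) x‖
  have h2 := sq_nonneg ‖y‖
  have h3 := sq_nonneg ‖powApply e lam (3 / 4) x‖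
  unfold kirchhoffEnergy; linarith

theorem norm_three_quarters_sq_le_kirchhoffEnergy (e : HilbertBasis ι ℝ H) (lam : ι → ℝ)
    (x y : H) : ‖powApply e lam (3 / 4) x‖ ^ 2 ≤ kirchhoffEnergy e lam x y := by
  have h1 := sq_nonneg ‖powApply e lam (1 / 2) x‖
  have h2 := sq_nonneg ‖powApply e lam (1 / 4) y‖
  have h3 := sq_nonneg ‖y‖
  unfold kirchhoffEnergy; linarith

/-- Closedness of `A^s`, uniformly in time. -/
theorem isC0InPow_of_tendstoUniformlyOn {α : Type*} {l : Filter α} [l.NeBot] {s : ℝ}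
    {F : α → ℝ → H} {f g : ℝ → H} (hl : ∀ k, 0 ≤ lam k) (hF : ∀ a, IsC0InPow e lam s T (F a))
    (hf : TendstoUniformlyOn F f l (Icc 0 T))
    (hg : TendstoUniformlyOn (fun a t => powApply e lam s (F a t)) g l (Icc 0 T)) :
    IsC0InPow e lam s T f ∧ ∀ t ∈ Icc 0 T, powApply e lam s (f t) = g t := by
  have key : ∀ t ∈ Icc 0 T, f t ∈ powDomain e lam s ∧ powApply e lam s (f t) = g t := by
    intro t ht
    refine mem_powDomain_and_powApply_eq hl fun k => ?_
    have h1 := (hg.tendsto_at ht).inner (𝕜 := ℝ) (tendsto_const_nhds (x := e k))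
    have h2 := ((hf.tendsto_at ht).inner (𝕜 := ℝ) (tendsto_const_nhds (x := e k))).const_mul
      (lam k ^ (2 * s))
    refine tendsto_nhds_unique h1 (h2.congr fun a => ?_)
    rw [inner_powApply hl ((hF a).1 t ht)]
  have hgc : ContinuousOn g (Icc 0 T) :=
    hg.continuousOn (Frequently.of_forall fun a => (hF a).continuousOn_powApply)
  refine ⟨⟨fun t ht => (key t ht).1, fun t ht => ⟨hf.continuousOn
    (Frequently.of_forall fun a => (hF a).continuousOn) t ht, ?_⟩⟩, fun t ht => (key t ht).2⟩
  exact (hgc.congr fun t ht => (key t ht).2) t ht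

/-- A net of solutions with bounded energy which is uniformly Cauchy in the energy norm converges
to a solution. -/
theorem exists_limit_solution [CompleteSpace H] {α : Type*} [SemilatticeSup α] [Nonempty α]
    [Countable α] (hl : ∀ k, 0 ≤ lam k) (hm : ContDiffOn ℝ 1 m (Ici 0))
    (hm0 : ∀ σ, 0 ≤ σ → 0 ≤ m σ) (hT : 0 ≤ T) {R : ℝ} {U V : α → ℝ → H} {a b : H}
    (hUV : ∀ p, IsModalSolution e lam m T (U p) (V p))
    (hR : ∀ᶠ p in atTop, ∀ t ∈ Icc 0 T, kirchhoffEnergy e lam (U p t) (V p t) ≤ R)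
    (ha : Tendsto (fun p => U p 0) atTop (𝓝 a)) (hb : Tendsto (fun p => V p 0) atTop (𝓝 b))
    (hC : ∀ δ : ℝ, 0 < δ → ∃ N, ∀ p, N ≤ p → ∀ q, N ≤ q → ∀ t ∈ Icc 0 T,
      kirchhoffEnergy e lam (U p t - U q t) (V p t - V q t) ≤ δ) :
    ∃ u v : ℝ → H, IsModalSolution e lam m T u v ∧ u 0 = a ∧ v 0 = b := by
  have hCs : ∀ δ : ℝ, 0 < δ → ∃ N, ∀ p, N ≤ p → ∀ q, N ≤ q → ∀ t ∈ Icc 0 T,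
      kirchhoffEnergy e lam (U p t - U q t) (V p t - V q t) ≤ δ ^ 2 := fun δ hδ =>
    hC _ (by positivity)
  have h0 : (0 : ℝ) ∈ Icc 0 T := ⟨le_rfl, hT⟩
  obtain ⟨v, hv⟩ := exists_tendstoUniformlyOn_of_cauchy (F := V) (S := Icc 0 T) fun δ hδ => by
    obtain ⟨N, hN⟩ := hCs δ hδ
    exact ⟨N, fun p hp q hq t ht => le_of_sq_le_sq
      ((norm_vel_sq_le_kirchhoffEnergy e lam _ _).trans (hN p hp q hq t ht)) hδ.le⟩
  obtain ⟨v', hv'⟩ := exists_tendstoUniformlyOn_of_cauchy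
      (F := fun p t => powApply e lam (1 / 4) (V p t)) (S := Icc 0 T) fun δ hδ => by
    obtain ⟨N, hN⟩ := hCs δ hδ
    refine ⟨N, fun p hp q hq t ht => le_of_sq_le_sq ?_ hδ.le⟩
    rw [← (powDomain_sub hl ((hUV p).vel_continuous.1 t ht) ((hUV q).vel_continuous.1 t ht)).2]
    exact (norm_quarter_vel_sq_le_kirchhoffEnergy e lam _ _).trans (hN p hp q hq t ht)
  obtain ⟨u', hu'⟩ := exists_tendstoUniformlyOn_of_cauchy
      (F := fun p t => powApply e lam (3 / 4) (U p t)) (S := Icc 0 T) fun δ hδ => by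
    obtain ⟨N, hN⟩ := hCs δ hδ
    refine ⟨N, fun p hp q hq t ht => le_of_sq_le_sq ?_ hδ.le⟩
    rw [← (powDomain_sub hl ((hUV p).pos_continuous.1 t ht) ((hUV q).pos_continuous.1 t ht)).2]
    exact (norm_three_quarters_sq_le_kirchhoffEnergy e lam _ _).trans (hN p hp q hq t ht)
  -- The energy contains no `|u|²`, so it misses the kernel of `A`. Convergence of positions comes
  -- from that of the initial positions and the mean value inequality with the velocities.
  obtain ⟨u, hu⟩ := exists_tendstoUniformlyOn_of_cauchy (F := U) (S := Icc 0 T) fun δ hδ => by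
    have hκ : 0 < δ / (2 * (T + 1)) := by positivity
    obtain ⟨N, hN⟩ := hCs _ hκ
    obtain ⟨N', hN'⟩ := Metric.cauchySeq_iff.1 ha.cauchySeq (δ / 2) (half_pos hδ)
    refine ⟨N ⊔ N', fun p hp q hq t ht => ?_⟩
    have hd : ∀ r ∈ Icc 0 T, HasDerivWithinAt (fun r => U p r - U q r) (V p r - V q r)
        (Icc 0 T) r := fun r hr =>
      (hasDerivWithinAt_of_coord e (hUV p).vel_continuous.continuousOn (hUV p).modes.pos hr).sub
      (hasDerivWithinAt_of_coord e (hUV q).vel_continuous.continuousOn (hUV q).modes.pos hr)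
    have hmv := (convex_Icc 0 T).norm_image_sub_le_of_norm_hasDerivWithin_le hd
      (fun r hr => le_of_sq_le_sq ((norm_vel_sq_le_kirchhoffEnergy e lam _ _).trans
        (hN p (le_sup_left.trans hp) q (le_sup_left.trans hq) r hr)) hκ.le) h0 ht
    have hi := hN' p (le_sup_right.trans hp) q (le_sup_right.trans hq)
    rw [dist_eq_norm] at hi
    have htri := norm_add_le (U p t - U q t - (U p 0 - U q 0)) (U p 0 - U q 0)
    rw [sub_add_cancel] at htri
    rw [sub_zero, Real.norm_eq_abs, abs_of_nonneg ht.1] at hmv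
    have hκt : δ / (2 * (T + 1)) * t ≤ δ / 2 := by
      rw [div_mul_eq_mul_div, div_le_div_iff₀ (by positivity) two_pos]
      nlinarith [ht.2]
    linarith
  obtain ⟨huC, -⟩ := isC0InPow_of_tendstoUniformlyOn hl (fun p => (hUV p).pos_continuous) hu hu'
  obtain ⟨hvC, -⟩ := isC0InPow_of_tendstoUniformlyOn hl (fun p => (hUV p).vel_continuous) hv hv'
  have hu'eq := (isC0InPow_of_tendstoUniformlyOn hl (fun p => (hUV p).pos_continuous) hu hu').2
  have hhalf : ∀ t ∈ Icc 0 T, Tendsto (fun p => ‖powApply e lam (1 / 2) (U p t)‖ ^ 2) atTop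
      (𝓝 (‖powApply e lam (1 / 2) (u t)‖ ^ 2)) := fun t ht => by
    have : TendstoInPow e lam (3 / 4) (fun p => U p t) atTop (u t) :=
      ⟨hu.tendsto_at ht, by rw [hu'eq t ht]; exact hu'.tendsto_at ht⟩
    exact ((this.half hl (Eventually.of_forall fun p => (hUV p).pos_continuous.1 t ht)
      (huC.1 t ht)).norm.pow 2)
  obtain ⟨M, L, hM0, hL0, hM, -, -⟩ := exists_bounds_of_contDiffOn hm R
  have hcoord : ∀ (f : H) k, |inner ℝ f (e k)| ≤ ‖f‖ := fun f k => by
    simpa [e.orthonormal.norm_eq_one k] using abs_real_inner_le_norm f (e k)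
  have hinner : ∀ {F : α → ℝ → H} {f : ℝ → H}, TendstoUniformlyOn F f atTop (Icc 0 T) → ∀ k,
      ∀ t ∈ Icc 0 T, Tendsto (fun p => inner ℝ (F p t) (e k)) atTop (𝓝 (inner ℝ (f t) (e k))) :=
    fun hF k t ht => (hF.tendsto_at ht).inner tendsto_const_nhds
  have hspeed : ∀ {w : ℝ → H}, IsC0InPow e lam (3 / 4) T w →
      ContinuousOn (fun t => m (‖powApply e lam (1 / 2) (w t)‖ ^ 2)) (Icc 0 T) := fun hw =>
    hm.continuousOn.comp ((hw.continuousOn_half hl).norm.pow 2) fun t _ => mem_Ici.2 (sq_nonneg _)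
  refine ⟨u, v, ⟨huC, hvC, fun k t ht => ?_, fun k t ht => ?_⟩,
    tendsto_nhds_unique (hu.tendsto_at h0) ha, tendsto_nhds_unique (hv.tendsto_at h0) hb⟩
  · refine hasDerivWithinAt_of_tendsto_of_bounded (l := atTop) (B := √R)
      (F := fun p t => inner ℝ (U p t) (e k)) (G := fun p t => inner ℝ (V p t) (e k))
      (g := fun t => inner ℝ (v t) (e k))
      (Eventually.of_forall fun p => (hUV p).modes.pos k)
      (Eventually.of_forall fun p =>
        (hUV p).vel_continuous.continuousOn.inner continuousOn_const) ?_
      (hinner hu k) (hinner hv k) (hvC.continuousOn.inner continuousOn_const) ht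
    filter_upwards [hR] with p hp t ht
    exact (hcoord _ k).trans (Real.le_sqrt_of_sq_le
      ((norm_vel_sq_le_kirchhoffEnergy e lam _ _).trans (hp t ht)))
  · refine hasDerivWithinAt_of_tendsto_of_bounded (l := atTop) (B := M * (lam k * √R))
      (F := fun p t => inner ℝ (V p t) (e k))
      (G := fun p t => -(m (‖powApply e lam (1 / 2) (U p t)‖ ^ 2) *
        (lam k ^ 2 * inner ℝ (U p t) (e k))))
      (g := fun t => -(m (‖powApply e lam (1 / 2) (u t)‖ ^ 2) *
        (lam k ^ 2 * inner ℝ (u t) (e k))))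
      (Eventually.of_forall fun p => (hUV p).modes.vel k)
      (Eventually.of_forall fun p => ((hspeed (hUV p).pos_continuous).mul
        (((hUV p).pos_continuous.continuousOn.inner continuousOn_const).const_mul _)).neg) ?_
      (hinner hv k) (fun t ht => ?_)
      ((hspeed huC).mul ((huC.continuousOn.inner continuousOn_const).const_mul _)).neg ht
    · filter_upwards [hR] with p hp t ht
      have hσ := (norm_half_sq_le_kirchhoffEnergy e lam (U p t) (V p t)).trans (hp t ht)
      -- The energy bounds `λ_k u_k` through `A^{1/2}u`, though not `u_k`; the remaining factor
      -- `λ_k` is fixed with `k`.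
      have h1 := (hcoord (powApply e lam (1 / 2) (U p t)) k).trans (Real.le_sqrt_of_sq_le hσ)
      rw [inner_powApply hl (half_of_three_quarters hl ((hUV p).pos_continuous.1 t ht)),
        rpow_two_mul_half] at h1
      rw [abs_neg, abs_mul, abs_of_nonneg (hm0 _ (sq_nonneg _)), pow_two (lam k), mul_assoc,
        abs_mul (lam k), abs_of_nonneg (hl k)]
      exact mul_le_mul (hM _ ⟨sq_nonneg _, hσ⟩) (mul_le_mul_of_nonneg_left h1 (hl k))
        (mul_nonneg (hl k) (abs_nonneg _)) hM0
    · have hc : Tendsto (fun p => m (‖powApply e lam (1 / 2) (U p t)‖ ^ 2)) atTop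
          (𝓝 (m (‖powApply e lam (1 / 2) (u t)‖ ^ 2))) :=
        (hm.continuousOn _ (mem_Ici.2 (sq_nonneg _))).tendsto.comp
          (tendsto_nhdsWithin_iff.2 ⟨hhalf t ht,
            Eventually.of_forall fun p => mem_Ici.2 (sq_nonneg _)⟩)
      exact (hc.mul ((hinner hu k t ht).const_mul _)).neg

/-! ### Existence near a given solution, and the theorem. -/

/-- Near the initial data of a solution on `[0,T]` all initial data admit a solution on
`[0,T]`. -/
theorem IsModalSolution.exists_solution_near [CompleteSpace H] [Countable ι]
    (hl : ∀ k, 0 ≤ lam k) (hm : ContDiffOn ℝ 1 m (Ici 0)) {ν₀ : ℝ} (hν₀ : 0 < ν₀)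
    (hmν : ∀ σ, 0 ≤ σ → ν₀ ≤ m σ) (hT : 0 ≤ T) (h : IsModalSolution e lam m T u v) :
    ∃ η : ℝ, 0 < η ∧ ∀ a b : H, a ∈ powDomain e lam (3 / 4) → b ∈ powDomain e lam (1 / 4) →
      kirchhoffEnergy e lam (a - u 0) (b - v 0) < η →
        ∃ y z : ℝ → H, IsModalSolution e lam m T y z ∧ y 0 = a ∧ z 0 = b := by
  classical
  have hm0 : ∀ σ, 0 ≤ σ → 0 ≤ m σ := fun σ hσ => hν₀.le.trans (hmν σ hσ)
  have h0 : (0 : ℝ) ∈ Icc 0 T := ⟨le_rfl, hT⟩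
  obtain ⟨η, hη, hstab⟩ := h.exists_stability hl hm hν₀ hmν hT one_pos
  obtain ⟨R, hR0, hR⟩ := h.exists_energy_le hl
  obtain ⟨C, hC, hmain⟩ := exists_energy_sub_le e hl hm hν₀ hmν
    (by positivity : 0 ≤ 2 + 2 * R) T
  -- The truncated data are within `η/4` of `(a,b)`, which are within `η/4` of the data of `u`. The
  -- factor `2` in the triangle inequality for `E` gives `η` in total.
  refine ⟨η / 4, by positivity, fun a b ha hb hab => ?_⟩
  choose U V hUV hU0 hV0 using exists_truncated_solution (e := e) hl hm hm0 a b hT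
  have hU0m : ∀ s, U s 0 ∈ powDomain e lam (3 / 4) := fun s => (hUV s).pos_continuous.1 0 h0
  have hV0m : ∀ s, V s 0 ∈ powDomain e lam (1 / 4) := fun s => (hUV s).vel_continuous.1 0 h0
  set D : Finset ι → ℝ := fun s => kirchhoffEnergy e lam (U s 0 - a) (V s 0 - b) with hD
  have hDeq : ∀ s, D s = kirchhoffEnergy e lam a b -
      ∑ k ∈ s, (1 + lam k) * (inner ℝ b (e k) ^ 2 + lam k ^ 2 * inner ℝ a (e k) ^ 2) :=
    fun s => by rw [hD]; simp only [hU0, hV0]; exact kirchhoffEnergy_truncation_sub hl ha hb s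
  have hanti : Antitone D := fun s s' hss => by
    rw [hDeq, hDeq]
    exact sub_le_sub_left (Finset.sum_le_sum_of_subset_of_nonneg hss fun k _ _ => by
      have := hl k; positivity) _
  have hsmall : ∀ κ : ℝ, 0 < κ → ∃ r, ∀ s, r ≤ s → D s < κ := fun κ hκ => by
    obtain ⟨r, hr⟩ :=
      ((hasSum_kirchhoffEnergy hl ha hb).eventually_const_lt (sub_lt_self _ hκ)).exists
    refine ⟨r, fun s hs => (hanti hs).trans_lt ?_⟩
    rw [hDeq]; linarith
  obtain ⟨r₀, hr₀⟩ := hsmall (η / 4) (by positivity)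
  have hbound : ∀ s, r₀ ≤ s → ∀ t ∈ Icc 0 T,
      kirchhoffEnergy e lam (U s t) (V s t) ≤ 2 + 2 * R := fun s hs t ht => by
    have hu0 := h.pos_continuous.1 0 h0
    have hv0 := h.vel_continuous.1 0 h0
    have h1 := kirchhoffEnergy_sub_le hl (powDomain_sub hl (hU0m s) ha).1
      (powDomain_sub hl (hV0m s) hb).1 (powDomain_sub hl hu0 ha).1 (powDomain_sub hl hv0 hb).1
    rw [sub_sub_sub_cancel_right, sub_sub_sub_cancel_right,
      kirchhoffEnergy_sub_comm hl hu0 hv0 ha hb] at h1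
    have h2 := hstab T (U s) (V s) le_rfl (hUV s) (by have := hr₀ s hs; linarith) t ht
    have h3 := kirchhoffEnergy_le_sub hl ((hUV s).pos_continuous.1 t ht)
      ((hUV s).vel_continuous.1 t ht) (h.pos_continuous.1 t ht) (h.vel_continuous.1 t ht)
    linarith [hR t ht]
  refine exists_limit_solution hl hm hm0 hT hUV
    (eventually_atTop.2 ⟨r₀, hbound⟩) (by simpa only [hU0] using tendsto_truncation e a)
    (by simpa only [hV0] using tendsto_truncation e b) fun δ hδ => ?_
  set κ := δ / (2 * (C + 1)) with hκ
  have hκ0 : 0 < κ := by positivity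
  have hCκ : C * (2 * κ) ≤ δ := by
    rw [hκ, ← mul_div_assoc, ← mul_div_assoc, div_le_iff₀ (by positivity)]
    nlinarith
  obtain ⟨r, hr⟩ := hsmall κ hκ0
  set Λ := ∑ k ∈ r, lam k with hΛ
  have hΛ0 : 0 ≤ Λ := Finset.sum_nonneg fun k _ => hl k
  have hrΛ : ∀ k ∈ r, lam k ≤ Λ := fun k hk =>
    Finset.single_le_sum (f := lam) (fun k _ => hl k) hk
  -- The difference of two truncations is at most `2 D p + 2 D q`; the factor `4(1+Λ)²` makes it
  -- less than `κ` after amplification by `(1+Λ)²`.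
  obtain ⟨r₁, hr₁⟩ := hsmall (κ / (4 * (1 + Λ) ^ 2)) (by positivity)
  refine ⟨r ⊔ r₀ ⊔ r₁, fun p hp q hq t ht => ?_⟩
  have hp0 : r₀ ≤ p := le_sup_right.trans (le_sup_left.trans hp)
  have hq0 : r₀ ≤ q := le_sup_right.trans (le_sup_left.trans hq)
  have hqr : r ⊆ q := le_sup_left.trans (le_sup_left.trans hq)
  refine (hmain T (U q) (V q) (U p) (V p) le_rfl (hUV q) (hUV p) (hbound q hq0) (hbound p hp0)
    r Λ hΛ0 hrΛ t ht).trans (le_trans (mul_le_mul_of_nonneg_left ?_ hC) hCκ)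
  have hp1 := hr₁ p (le_sup_right.trans hp)
  have hq1 := hr₁ q (le_sup_right.trans hq)
  rw [lt_div_iff₀ (by positivity)] at hp1 hq1
  have h1 := kirchhoffEnergy_sub_le hl (powDomain_sub hl (hU0m p) ha).1
      (powDomain_sub hl (hV0m p) hb).1 (powDomain_sub hl (hU0m q) ha).1
      (powDomain_sub hl (hV0m q) hb).1
  rw [sub_sub_sub_cancel_right, sub_sub_sub_cancel_right] at h1
  have h2 := mul_le_mul_of_nonneg_left h1 (sq_nonneg (1 + Λ))
  -- As `r ⊆ q`, truncation leaves the modes in `r` unchanged and can only shrink the tail. One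
  -- choice of `r` thus serves all `q`.
  have htail : kirchhoffEnergy e lam (U q 0) (V q 0) - ∑ k ∈ r, (1 + lam k) *
      (inner ℝ (V q 0) (e k) ^ 2 + lam k ^ 2 * inner ℝ (U q 0) (e k) ^ 2) ≤ D r := by
    have h3 : ∑ k ∈ r, (1 + lam k) *
        (inner ℝ (V q 0) (e k) ^ 2 + lam k ^ 2 * inner ℝ (U q 0) (e k) ^ 2) =
        ∑ k ∈ r, (1 + lam k) * (inner ℝ b (e k) ^ 2 + lam k ^ 2 * inner ℝ a (e k) ^ 2) :=
      Finset.sum_congr rfl fun k hk => by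
        rw [hU0, hV0, inner_finset_sum_smul, inner_finset_sum_smul, if_pos (hqr hk),
          if_pos (hqr hk)]
    rw [h3, hU0, hV0, kirchhoffEnergy_truncation hl, hDeq]
    exact sub_le_sub_right (sum_modes_le_energy hl ha hb q) _
  have h4 := hr r le_rfl
  simp only [hD] at htail h4 hp1 hq1
  nlinarith

end

theorem ofReal_le_lifeSpan {ι H : Type*} [NormedAddCommGroup H] [InnerProductSpace ℝ H]
    {A : H →ₗ.[ℝ] H} {e : HilbertBasis ι ℝ H} {lam : ι → ℝ} {m : ℝ → ℝ} {u₀ u₁ : H}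
    {T : ℝ} (hT : 0 < T) {u v : ℝ → H} (h : IsKirchhoffSolution A e lam m T u₀ u₁ u v) :
    ENNReal.ofReal T ≤ lifeSpan A e lam m u₀ u₁ :=
  le_sSup ⟨T, hT, rfl, u, v, h⟩

theorem theorem2p1 {ι H : Type*} [Countable ι] [NormedAddCommGroup H] [InnerProductSpace ℝ H]
    [CompleteSpace H] (A : H →ₗ.[ℝ] H) (e : HilbertBasis ι ℝ H) (lam : ι → ℝ)
    (hA : IsDiagonalSelfAdjoint A e lam)
    (m : ℝ → ℝ) (hm : ContDiffOn ℝ 1 m (Ici 0)) (ν₀ : ℝ) (hν₀ : 0 < ν₀)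
    (hmν : ∀ σ, 0 ≤ σ → ν₀ ≤ m σ)
    (u₀ u₁ : H) (hu₀ : u₀ ∈ powDomain e lam (3 / 4)) (hu₁ : u₁ ∈ powDomain e lam (1 / 4))
    (u₀ε u₁ε : ℝ → H)
    (hu₀ε : ∀ ε, 0 < ε → u₀ε ε ∈ powDomain e lam (3 / 4))
    (hu₁ε : ∀ ε, 0 < ε → u₁ε ε ∈ powDomain e lam (1 / 4))
    (hlim₀ : TendstoInPow e lam (3 / 4) u₀ε (𝓝[>] 0) u₀)
    (hlim₁ : TendstoInPow e lam (1 / 4) u₁ε (𝓝[>] 0) u₁) :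
    -- lower semicontinuity of the life span
    lifeSpan A e lam m u₀ u₁
        ≤ liminf (fun ε => lifeSpan A e lam m (u₀ε ε) (u₁ε ε)) (𝓝[>] 0) ∧
    -- continuous dependence on the initial data
    (∀ T : ℝ, 0 < T → ENNReal.ofReal T < lifeSpan A e lam m u₀ u₁ →
      ∀ u v : ℝ → H, IsKirchhoffSolution A e lam m T u₀ u₁ u v →
        ∀ δ : ℝ, 0 < δ → ∀ᶠ ε in 𝓝[>] (0 : ℝ),
          ENNReal.ofReal T < lifeSpan A e lam m (u₀ε ε) (u₁ε ε) ∧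
          ∀ uε vε : ℝ → H, IsKirchhoffSolution A e lam m T (u₀ε ε) (u₁ε ε) uε vε →
            ∀ t ∈ Icc 0 T, kirchhoffEnergy e lam (uε t - u t) (vε t - v t) ≤ δ) ∧
    -- Lipschitz-type rate for a more regular limit datum
    (u₀ ∈ powDomain e lam (5 / 4) → u₁ ∈ powDomain e lam (3 / 4) →
      ∀ T : ℝ, 0 < T → ENNReal.ofReal T < lifeSpan A e lam m u₀ u₁ →
      ∀ u v : ℝ → H, IsKirchhoffSolution A e lam m T u₀ u₁ u v →
        ∃ Γ : ℝ, ∀ᶠ ε in 𝓝[>] (0 : ℝ),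
          ENNReal.ofReal T < lifeSpan A e lam m (u₀ε ε) (u₁ε ε) ∧
          ∀ uε vε : ℝ → H, IsKirchhoffSolution A e lam m T (u₀ε ε) (u₁ε ε) uε vε →
            ∀ t ∈ Icc 0 T, kirchhoffEnergy e lam (uε t - u t) (vε t - v t)
              ≤ Γ * kirchhoffEnergy e lam (uε 0 - u 0) (vε 0 - v 0)) := by

  have hl := hA.lam_nonneg
  have hpos : ∀ᶠ ε : ℝ in 𝓝[>] 0, 0 < ε := self_mem_nhdsWithin
  have hE : Tendsto (fun ε => kirchhoffEnergy e lam (u₀ε ε - u₀) (u₁ε ε - u₁)) (𝓝[>] 0) (𝓝 0) :=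
    tendsto_kirchhoffEnergy_sub hl hlim₀ hlim₁ (hpos.mono hu₀ε) hu₀ (hpos.mono hu₁ε) hu₁
  have hnear : ∀ T : ℝ, 0 < T → ∀ u v : ℝ → H, IsKirchhoffSolution A e lam m T u₀ u₁ u v →
      ∀ᶠ ε in 𝓝[>] (0 : ℝ),
        ENNReal.ofReal T ≤ lifeSpan A e lam m (u₀ε ε) (u₁ε ε) := fun T hT u v h => by
    obtain ⟨η, hη, hex⟩ := (h.isModalSolution hA).exists_solution_near hl hm hν₀ hmν hT.le
    filter_upwards [hpos, hE.eventually_lt_const hη] with ε hε hεη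
    obtain ⟨y, z, hyz, hy0, hz0⟩ := hex (u₀ε ε) (u₁ε ε) (hu₀ε ε hε) (hu₁ε ε hε)
      (by rwa [h.init_pos, h.init_vel])
    have hsol := hyz.isKirchhoffSolution hA hm.continuousOn
    rw [hy0, hz0] at hsol
    exact ofReal_le_lifeSpan hT hsol
  -- Strictness comes from a solution on some longer interval `[0,T₁]`, near which perturbed
  -- solutions also exist on `[0,T₁]`.
  have hlt : ∀ T : ℝ, ENNReal.ofReal T < lifeSpan A e lam m u₀ u₁ →
      ∀ᶠ ε in 𝓝[>] (0 : ℝ),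
        ENNReal.ofReal T < lifeSpan A e lam m (u₀ε ε) (u₁ε ε) := fun T hTls => by
    obtain ⟨_, ⟨T₁, hT₁, rfl, u, v, h⟩, hTT₁⟩ := lt_sSup_iff.1 hTls
    exact (hnear T₁ hT₁ u v h).mono fun ε hε => hTT₁.trans_le hε
  have hstab : ∀ T : ℝ, 0 < T → ∀ u v : ℝ → H, IsKirchhoffSolution A e lam m T u₀ u₁ u v →
      ∀ δ : ℝ, 0 < δ → ∀ᶠ ε in 𝓝[>] (0 : ℝ), ∀ uε vε : ℝ → H,
        IsKirchhoffSolution A e lam m T (u₀ε ε) (u₁ε ε) uε vε →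
          ∀ t ∈ Icc 0 T, kirchhoffEnergy e lam (uε t - u t) (vε t - v t) ≤ δ := by
    intro T hT u v h δ hδ
    obtain ⟨η, hη, hst⟩ := (h.isModalSolution hA).exists_stability hl hm hν₀ hmν hT.le hδ
    filter_upwards [hE.eventually_lt_const hη] with ε hεη uε vε hε
    exact hst T uε vε le_rfl (hε.isModalSolution hA)
      (by rwa [h.init_pos, h.init_vel, hε.init_pos, hε.init_vel])
  refine ⟨?_, fun T hT hTls u v h δ hδ => (hlt T hTls).and (hstab T hT u v h δ hδ), ?_⟩
  · refine sSup_le ?_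
    rintro _ ⟨T, hT, rfl, u, v, h⟩
    exact le_liminf_of_le (by isBoundedDefault) (hnear T hT u v h)
  · intro hu₀' hu₁' T hT hTls u v h
    have hM := h.isModalSolution hA
    obtain ⟨R, hR0, hR⟩ := hM.exists_energy_le hl
    obtain ⟨Γ, hΓ⟩ := hM.exists_energy_lipschitz hl hm hν₀ hmν (by rwa [h.init_pos])
      (by rwa [h.init_vel]) (by positivity : 0 ≤ 2 + 2 * R)
      (fun t ht => (hR t ht).trans (by linarith))
    -- Stability with tolerance `1` supplies the uniform energy bound `2 + 2R` on which `Γ` depends.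
    refine ⟨Γ, (hlt T hTls).and ((hstab T hT u v h 1 one_pos).mono fun ε hε uε vε hsol => ?_)⟩
    have hMε := hsol.isModalSolution hA
    refine hΓ uε vε hMε fun t ht => ?_
    have h1 := kirchhoffEnergy_le_sub hl (hMε.pos_continuous.1 t ht)
      (hMε.vel_continuous.1 t ht) (hM.pos_continuous.1 t ht) (hM.vel_continuous.1 t ht)
    linarith [hε uε vε hsol t ht, hR t ht]
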